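/- Let $N\ge 3$ and let $\Omega\subset\mathbb{R}^N$ be a bounded domain (connected open set) with boundary of class $C^2$ and $0\in\Omega$. Put $d(x)=\operatorname{dist}(x,\partial\Omega)$. Then there is a constant $C=C(\Omega)\in(0,\tfrac14]$ such that $$\int_\Omega\Big(|\nabla u|^2-\frac{(N-2)^2}{4|x|^2}\,u^2\Big)\,dx\ \ge\ C\int_\Omega\frac{u^2}{d^2(x)}\,dx\qquad\text{for all } u\in C_c^\infty(\Omega),$$ where both integrands are integrable over $\Omega$. Moreover, the inequality holds with $C=\tfrac14$ whenever $$-\operatorname{div}\big(|x|^{2-N}\nabla d(x)\big)\ge 0\quad\text{for a.e. }x\in\Omega,$$ meaning that for almost every $x\in\Omega$ the vector field $|x|^{2-N}\nabla d$ is differentiable at $x$ and its divergence there is $\le 0$. For every $R>0$ the ball $\Omega=B(0,R)$ centred at the origin satisfies this condition, so in this case the inequality holds with $C=\tfrac14$. -/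

import Mathlib

open MeasureTheory
open scoped ContDiff Gradient

noncomputable section

/-- A bounded domain (nonempty connected open set) of `ℝ^N` of class `C²`: near each boundary point
it is the strict sublevel set of a `C²` function with nonvanishing differential at that point. -/
structure IsBoundedC2Domain {N : ℕ} (Ω : Set (EuclideanSpace ℝ (Fin N))) : Prop where
  isOpen : IsOpen Ω
  isConnected : IsConnected Ω
  isBounded : Bornology.IsBounded Ω
  boundary : ∀ p ∈ frontier Ω, ∃ (U : Set (EuclideanSpace ℝ (Fin N)))
    (ρ : EuclideanSpace ℝ (Fin N) → ℝ), IsOpen U ∧ p ∈ U ∧ ContDiffOn ℝ 2 ρ U ∧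
      fderiv ℝ ρ p ≠ 0 ∧ Ω ∩ U = {y ∈ U | ρ y < 0}

/-- The distance `d(x) = dist(x, ∂Ω)`. -/
def bdryDist {N : ℕ} (Ω : Set (EuclideanSpace ℝ (Fin N))) (x : EuclideanSpace ℝ (Fin N)) : ℝ :=
  Metric.infDist x (frontier Ω)

/-- `u ∈ C_c^∞(Ω)`, real-valued and extended by zero to the whole space. -/
structure IsTestFunction {N : ℕ} (Ω : Set (EuclideanSpace ℝ (Fin N)))
    (u : EuclideanSpace ℝ (Fin N) → ℝ) : Prop where
  smooth : ContDiff ℝ ∞ u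
  compactSupport : HasCompactSupport u
  support_subset : tsupport u ⊆ Ω

/-- The divergence `∑ᵢ ∂ᵢ Fᵢ (x)` of a vector field (meaningful where `F` is differentiable). -/
def vdiv {N : ℕ} (F : EuclideanSpace ℝ (Fin N) → EuclideanSpace ℝ (Fin N))
    (x : EuclideanSpace ℝ (Fin N)) : ℝ :=
  ∑ i : Fin N, (fderiv ℝ F x (EuclideanSpace.single i 1)) i

/-- The vector field `|x|^{2-N} ∇d(x)`. -/
def weightedGradDist {N : ℕ} (Ω : Set (EuclideanSpace ℝ (Fin N)))
    (x : EuclideanSpace ℝ (Fin N)) : EuclideanSpace ℝ (Fin N) :=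
  ‖x‖ ^ (2 - (N : ℝ)) • ∇ (bdryDist Ω) x

/-- The condition `-div(|x|^{2-N} ∇d) ≥ 0` a.e. in `Ω`: at almost every point the divergence exists
in the classical sense and the inequality holds. -/
def DivCondition {N : ℕ} (Ω : Set (EuclideanSpace ℝ (Fin N))) : Prop :=
  ∀ᵐ x ∂(volume.restrict Ω),
    DifferentiableAt ℝ (weightedGradDist Ω) x ∧ 0 ≤ -vdiv (weightedGradDist Ω) x

/-- The improved Hardy inequality on `Ω` with constant `C`: for every `u ∈ C_c^∞(Ω)` both integrals
are finite and
`∫_Ω (|∇u|² - ((N-2)²/4) u²/|x|²) dx ≥ C ∫_Ω u²/d² dx`. -/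
def ImprovedHardy {N : ℕ} (Ω : Set (EuclideanSpace ℝ (Fin N))) (C : ℝ) : Prop :=
  ∀ u : EuclideanSpace ℝ (Fin N) → ℝ, IsTestFunction Ω u →
    IntegrableOn (fun x => ‖∇ u x‖ ^ 2 - ((N : ℝ) - 2) ^ 2 / (4 * ‖x‖ ^ 2) * u x ^ 2) Ω ∧
    IntegrableOn (fun x => u x ^ 2 / bdryDist Ω x ^ 2) Ω ∧
    C * ∫ x in Ω, u x ^ 2 / bdryDist Ω x ^ 2
      ≤ ∫ x in Ω, (‖∇ u x‖ ^ 2 - ((N : ℝ) - 2) ^ 2 / (4 * ‖x‖ ^ 2) * u x ^ 2)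

end

open Filter Topology

/-! The engine is the supersolution principle: if `w > 0` and `-Δw ≥ V w`, then testing with `u²/w`
gives `∫ V u² ≤ ∫ |∇u|²`. The natural `w` are built from the distance `d`, which is only Lipschitz,
so `Δw` is replaced by symmetric second differences. Picone's inequality holds exactly for
differences (`picone_translate`), and the passage `h → 0` is Fatou's lemma
(`IsSupersolution.integral_le`). Fatou needs a local upper bound on the second differences and their
limit almost everywhere. Concave kinks of `w`, such as those on the ridge of `d`, respect the upper
bound and so do no harm. The upper bounds come from touching `w` from above by smooth functions.

The origin is removed with cutoffs, at an energy cost `O(r^{2-N})` that vanishes for `N ≥ 3`. Off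
the origin every supersolution is the Hardy ground state `|x|^{-(N-2)/2}` times a factor `g`. The
ground state produces the Hardy potential exactly, leaving `Δg - (N-2) x·∇g/|x|²` to be controlled.

Under the divergence condition take `g = √d`. Since `|∇d| = 1`, the remainder is `-d^{-3/2}/4` plus
a multiple of `div(|x|^{2-N}∇d) ≤ 0`, which yields the constant `1/4`
(`isSupersolution_of_divCondition`).

For a general domain take `g = √(min d δ)`. The uniform exterior ball condition bounds `d` from
above by `|y - z| - r`, with equality at a given point. The error terms are then of size `κ/d`,
absorbed by half of `1/(4d²)` at the price of a term `-K ∫ u²` (`isSupersolution_truncated`). Taking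
`g = R² - |x|²` gives the Hardy inequality with an extra `+L ∫ u²` (`isSupersolution_paraboloid`),
and a convex combination of the two cancels the `L²` terms (`exists_improvedHardy`). -/

abbrev Euc (N : ℕ) := EuclideanSpace ℝ (Fin N)

noncomputable abbrev basisVec {N : ℕ} (i : Fin N) : Euc N := EuclideanSpace.single i (1 : ℝ)

/-- The sum of the second differences of `w` at `x` with step `h` along the coordinate axes. -/
noncomputable def secondDiff {N : ℕ} (w : Euc N → ℝ) (x : Euc N) (h : ℝ) : ℝ :=
  ∑ i, (w (x + h • basisVec i) + w (x - h • basisVec i) - 2 * w x)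

/-- `w` is a positive function on `O` whose second differences are locally bounded above, and which
satisfies `-Δ w ≥ V w` almost everywhere in the sense of second differences. -/
structure IsSupersolution {N : ℕ} (O : Set (Euc N)) (w V : Euc N → ℝ) : Prop where
  cont : ContinuousOn w O
  pos : ∀ x ∈ O, 0 < w x
  bdd : ∀ K ⊆ O, IsCompact K → ∃ M : ℝ, ∃ h₀ > 0, ∀ x ∈ K, ∀ h, 0 < h → h < h₀ →
    secondDiff w x h ≤ M * h ^ 2
  lim : ∀ᵐ x : Euc N, x ∈ O → ∀ ε > 0, ∀ᶠ h in 𝓝[>] (0 : ℝ),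
    secondDiff w x h ≤ (-V x * w x + ε) * h ^ 2

/-- The defect is the square `(aq - bp)²/(pq)`. In use, `a, b` are values of `u` and `p, q` values
of `w` at two neighbouring points. -/
theorem picone_pointwise {a b p q : ℝ} (hp : 0 < p) (hq : 0 < q) :
    (p - q) * (a ^ 2 / p - b ^ 2 / q) ≤ (a - b) ^ 2 := by
  have : (a - b) ^ 2 - (p - q) * (a ^ 2 / p - b ^ 2 / q) = (a * q - b * p) ^ 2 / (p * q) := by
    field_simp
    ring
  have h2 : 0 ≤ (a * q - b * p) ^ 2 / (p * q) := by positivity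
  linarith

theorem continuous_mul_of_tsupport_subset {X : Type*} [TopologicalSpace X] {O : Set X}
    (hO : IsOpen O) {g k : X → ℝ} (hg : Continuous g) (hgO : tsupport g ⊆ O)
    (hk : ContinuousOn k O) : Continuous fun x => g x * k x := by
  apply continuous_of_tsupport
  intro x hx
  have hx' : x ∈ tsupport g := tsupport_mul_subset_left hx
  exact hg.continuousAt.mul (hk.continuousAt (hO.mem_nhds (hgO hx')))

theorem integrable_mul_of_tsupport_subset {N : ℕ} {O : Set (Euc N)}
    (hO : IsOpen O) {g k : Euc N → ℝ} (hg : Continuous g) (hgc : HasCompactSupport g)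
    (hgO : tsupport g ⊆ O) (hk : ContinuousOn k O) : Integrable fun x => g x * k x :=
  (continuous_mul_of_tsupport_subset hO hg hgO hk).integrable_of_hasCompactSupport hgc.mul_right

theorem norm_smul_basisVec {N : ℕ} (h : ℝ) (i : Fin N) : ‖h • basisVec i‖ = |h| := by
  simp [norm_smul]

/-! ### Discrete Picone inequality and the supersolution principle -/

section Picone

variable {N : ℕ} {O : Set (Euc N)} {w u : Euc N → ℝ}

theorem continuous_sq_div (hO : IsOpen O) (hw : ContinuousOn w O) (hpos : ∀ x ∈ O, 0 < w x)
    (hu : Continuous u) (hK : tsupport u ⊆ O) : Continuous fun x => u x ^ 2 / w x := by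
  simp_rw [div_eq_mul_inv]
  refine continuous_mul_of_tsupport_subset hO (by fun_prop) ?_
    (hw.inv₀ fun x hx => (hpos x hx).ne')
  refine subset_trans (closure_mono ?_) hK
  intro x hx
  simpa using hx

theorem tsupport_sq_div : tsupport (fun x => u x ^ 2 / w x) ⊆ tsupport u := by
  refine closure_mono ?_
  intro x hx h
  apply hx
  simp [h]

/-- Integrating the pointwise inequality over the pairs `x`, `x + v` bounds `∫ (w(x+v) -
w(x))(g(x+v) - g(x))` with `g = u²/w`. Translation invariance is summation by parts: it moves the
difference off `g` and produces minus the second difference of `w`. -/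
theorem picone_translate (hO : IsOpen O) (hw : ContinuousOn w O) (hpos : ∀ x ∈ O, 0 < w x)
    (hu : Continuous u) (huc : HasCompactSupport u) (v : Euc N) (hK : tsupport u ⊆ O)
    (hv : ∀ x ∈ tsupport u, x + v ∈ O) (hv' : ∀ x ∈ tsupport u, x - v ∈ O) :
    Integrable (fun x => u x ^ 2 / w x * (w (x + v) + w (x - v) - 2 * w x)) ∧
    Integrable (fun x => (u (x + v) - u x) ^ 2) ∧
    -∫ x, u x ^ 2 / w x * (w (x + v) + w (x - v) - 2 * w x) ≤ ∫ x, (u (x + v) - u x) ^ 2 := by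
  set g : Euc N → ℝ := fun x => u x ^ 2 / w x with hg
  have hgcont : Continuous g := continuous_sq_div hO hw hpos hu hK
  have hgs : tsupport g ⊆ tsupport u := tsupport_sq_div
  have hgc : HasCompactSupport g := huc.of_isClosed_subset (isClosed_tsupport _) hgs
  have I1 : Integrable fun x => g x * w x :=
    integrable_mul_of_tsupport_subset hO hgcont hgc (hgs.trans hK) hw
  have I2 : Integrable fun x => g x * w (x + v) :=
    integrable_mul_of_tsupport_subset (O := (fun x => x + v) ⁻¹' O)
      (hO.preimage (by fun_prop)) hgcont hgc (fun x hx => hv x (hgs hx))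
      (hw.comp (by fun_prop) (fun x hx => hx))
  have I3 : Integrable fun x => g x * w (x - v) :=
    integrable_mul_of_tsupport_subset (O := (fun x => x - v) ⁻¹' O)
      (hO.preimage (by fun_prop)) hgcont hgc (fun x hx => hv' x (hgs hx))
      (hw.comp (by fun_prop) (fun x hx => hx))
  have I1' : Integrable fun x => g (x + v) * w (x + v) := I1.comp_add_right v
  have I3' : Integrable fun x => g (x + v) * w x := by
    simpa using I3.comp_add_right v
  have IU : Integrable (fun x => (u (x + v) - u x) ^ 2) := by
    have hc : HasCompactSupport fun x => u (x + v) - u x :=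
      (huc.comp_homeomorph (Homeomorph.addRight v)).sub huc
    refine Continuous.integrable_of_hasCompactSupport (by fun_prop) ?_
    exact hc.comp_left (g := fun t : ℝ => t ^ 2) (by simp)
  have e1 : ∫ x, g (x + v) * w (x + v) = ∫ x, g x * w x :=
    integral_add_right_eq_self (fun x => g x * w x) v
  have e3 : ∫ x, g (x + v) * w x = ∫ x, g x * w (x - v) := by
    simpa using integral_add_right_eq_self (μ := volume) (fun x => g x * w (x - v)) v
  have IG : Integrable (fun x => g x * (w (x + v) + w (x - v) - 2 * w x)) := by
    refine ((I2.add I3).sub (I1.const_mul 2)).congr (Eventually.of_forall fun x => ?_)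
    simp only [Pi.add_apply, Pi.sub_apply]; ring
  refine ⟨IG, IU, ?_⟩
  have e4 : ∫ x, g x * (w (x + v) + w (x - v) - 2 * w x)
      = (∫ x, g x * w (x + v)) + (∫ x, g x * w (x - v)) - 2 * ∫ x, g x * w x := by
    rw [← integral_const_mul, ← integral_add I2 I3, ← integral_sub]
    · congr 1; ext x; ring
    · exact I2.add I3
    · exact I1.const_mul 2
  have e5 : ∫ x, (w (x + v) - w x) * (g (x + v) - g x)
      = (∫ x, g (x + v) * w (x + v)) - (∫ x, g x * w (x + v)) - (∫ x, g (x + v) * w x)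
        + ∫ x, g x * w x := by
    rw [← integral_sub I1' I2, ← integral_sub, ← integral_add]
    · congr 1; ext x; ring
    · exact (I1'.sub I2).sub I3'
    · exact I1
    · exact I1'.sub I2
    · exact I3'
  have e6 : ∫ x, (w (x + v) - w x) * (g (x + v) - g x) ≤ ∫ x, (u (x + v) - u x) ^ 2 := by
    refine integral_mono_ae ?_ IU (Eventually.of_forall fun x => ?_)
    · refine (((I1'.sub I2).sub I3').add I1).congr (Eventually.of_forall fun x => ?_)
      simp only [Pi.add_apply, Pi.sub_apply]; ring
    · dsimp only
      by_cases h1 : x ∈ tsupport u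
      · exact picone_pointwise (hpos _ (hv x h1)) (hpos _ (hK h1))
      · by_cases h2 : x + v ∈ tsupport u
        · have h3 := hv' _ h2
          rw [add_sub_cancel_right] at h3
          exact picone_pointwise (hpos _ (hK h2)) (hpos _ h3)
        · simp [hg, image_eq_zero_of_notMem_tsupport h1, image_eq_zero_of_notMem_tsupport h2]
  rw [e4]
  rw [e5, e1, e3] at e6
  linarith

theorem picone_secondDiff (hO : IsOpen O) (hw : ContinuousOn w O) (hpos : ∀ x ∈ O, 0 < w x)
    (hu : Continuous u) (huc : HasCompactSupport u) (hK : tsupport u ⊆ O) :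
    ∃ h₀ > 0, ∀ h, 0 < h → h < h₀ →
      Integrable (fun x => u x ^ 2 / w x * secondDiff w x h) ∧
      -∫ x, u x ^ 2 / w x * secondDiff w x h
        ≤ ∫ x, ∑ i, (u (x + h • basisVec i) - u x) ^ 2 := by
  obtain ⟨δ, hδ, hsub⟩ := huc.isCompact.exists_cthickening_subset_open hO hK
  refine ⟨δ, hδ, fun h h0 h1 => ?_⟩
  have key := fun i : Fin N => picone_translate hO hw hpos hu huc (h • basisVec i) hK
    (fun x hx => hsub (Metric.mem_cthickening_of_dist_le _ x _ _ hx (by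
      rw [dist_eq_norm, add_sub_cancel_left, norm_smul_basisVec, abs_of_pos h0]; exact h1.le)))
    (fun x hx => hsub (Metric.mem_cthickening_of_dist_le _ x _ _ hx (by
      rw [dist_eq_norm, sub_sub_cancel_left, norm_neg, norm_smul_basisVec, abs_of_pos h0]
      exact h1.le)))
  simp only [secondDiff, Finset.mul_sum]
  refine ⟨integrable_finsetSum _ fun i _ => (key i).1, ?_⟩
  rw [integral_finsetSum _ fun i _ => (key i).1, integral_finsetSum _ fun i _ => (key i).2.1,
    ← Finset.sum_neg_distrib]
  exact Finset.sum_le_sum fun i _ => (key i).2.2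

theorem gradient_apply (u : Euc N → ℝ) (x : Euc N) (i : Fin N) :
    (∇ u x) i = fderiv ℝ u x (basisVec i) := by
  have h := InnerProductSpace.toDual_symm_apply (𝕜 := ℝ) (x := basisVec i) (y := fderiv ℝ u x)
  rw [← h, gradient, EuclideanSpace.inner_single_right]
  simp

theorem norm_gradient_sq (u : Euc N → ℝ) (x : Euc N) :
    ‖∇ u x‖ ^ 2 = ∑ i, (fderiv ℝ u x (basisVec i)) ^ 2 := by
  rw [EuclideanSpace.norm_sq_eq]
  refine Finset.sum_congr rfl fun i _ => ?_
  rw [gradient_apply, Real.norm_eq_abs, sq_abs]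

/-- Dominated convergence: the quotients are bounded by the squared Lipschitz constant of `u` and,
for steps at most `1`, vanish off a fixed compact thickening of the support. -/
theorem tendsto_integral_diff_sq (hu : ContDiff ℝ 1 u) (huc : HasCompactSupport u)
    {h : ℕ → ℝ} (hpos : ∀ n, 0 < h n) (hle : ∀ n, h n ≤ 1) (hlim : Tendsto h atTop (𝓝 0)) :
    Tendsto (fun n => ∫ x, (∑ i, (u (x + h n • basisVec i) - u x) ^ 2) / h n ^ 2) atTop
      (𝓝 (∫ x, ‖∇ u x‖ ^ 2)) := by
  obtain ⟨L, hL⟩ := hu.lipschitzWith_of_hasCompactSupport huc one_ne_zero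
  have hcK : IsCompact (Metric.cthickening 1 (tsupport u)) := huc.isCompact.cthickening
  refine tendsto_integral_of_dominated_convergence
    (Set.indicator (Metric.cthickening 1 (tsupport u)) fun _ => (N : ℝ) * (L : ℝ) ^ 2) ?_ ?_ ?_ ?_
  · intro n
    have := hu.continuous
    exact Continuous.aestronglyMeasurable (by fun_prop)
  · rw [integrable_indicator_iff hcK.measurableSet]
    exact integrableOn_const hcK.measure_lt_top.ne
  · intro n
    refine Eventually.of_forall fun x => ?_
    by_cases hx : x ∈ Metric.cthickening 1 (tsupport u)
    · rw [Set.indicator_of_mem hx, Real.norm_of_nonneg (by positivity),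
        div_le_iff₀ (pow_pos (hpos n) 2)]
      calc ∑ i, (u (x + h n • basisVec i) - u x) ^ 2
          ≤ ∑ i : Fin N, ((L : ℝ) * h n) ^ 2 := by
            refine Finset.sum_le_sum fun i _ => ?_
            have := hL.dist_le_mul (x + h n • basisVec i) x
            rw [dist_eq_norm, dist_eq_norm, add_sub_cancel_left, norm_smul_basisVec,
              abs_of_pos (hpos n), Real.norm_eq_abs] at this
            rw [← sq_abs]
            gcongr
        _ = _ := by simp; ring
    · rw [Set.indicator_of_notMem hx]
      have h0 : u x = 0 := image_eq_zero_of_notMem_tsupport fun h' =>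
        hx (Metric.self_subset_cthickening _ h')
      have h1 : ∀ i, u (x + h n • basisVec i) = 0 := fun i =>
        image_eq_zero_of_notMem_tsupport fun h' => hx
          (Metric.mem_cthickening_of_dist_le _ _ _ _ h' (by
            rw [dist_eq_norm, sub_add_cancel_left, norm_neg, norm_smul_basisVec,
              abs_of_pos (hpos n)]
            exact hle n))
      simp [h0, h1]
  · refine Eventually.of_forall fun x => ?_
    rw [norm_gradient_sq]
    simp_rw [Finset.sum_div]
    refine tendsto_finsetSum _ fun i _ => ?_
    have hd : HasLineDerivAt ℝ u (fderiv ℝ u x (basisVec i)) x (basisVec i) :=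
      ((hu.differentiable one_ne_zero) x).hasFDerivAt.hasLineDerivAt _
    have h2 := hd.tendsto_slope_zero_right
    have hh : Tendsto h atTop (𝓝[>] 0) :=
      tendsto_nhdsWithin_iff.2 ⟨hlim, Eventually.of_forall hpos⟩
    refine ((h2.comp hh).pow 2).congr fun n => ?_
    have := (hpos n).ne'
    simp only [Function.comp, smul_eq_mul]
    field_simp

theorem integrable_norm_gradient_sq (hu : ContDiff ℝ 1 u) (huc : HasCompactSupport u) :
    Integrable fun x => ‖∇ u x‖ ^ 2 := by
  have h1 : Continuous (fderiv ℝ u) := hu.continuous_fderiv one_ne_zero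
  simp_rw [norm_gradient_sq]
  refine integrable_finsetSum _ fun i _ => ?_
  refine Continuous.integrable_of_hasCompactSupport (by fun_prop) ?_
  exact (huc.fderiv ℝ).comp_left
    (g := fun l : Euc N →L[ℝ] ℝ => (l (basisVec i)) ^ 2) (by simp)

/-- Fatou's lemma for `M g - g · secondDiff w / h²`, where `g = u²/w`; the local upper bound on
second differences makes this nonnegative. A singular negative part of the Laplacian only helps,
which is why an almost everywhere inequality suffices. -/
theorem IsSupersolution.integral_le {V : Euc N → ℝ} (hw : IsSupersolution O w V) (hO : IsOpen O)
    (hu : ContDiff ℝ 1 u) (huc : HasCompactSupport u) (hK : tsupport u ⊆ O)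
    (hV : Integrable fun x => V x * u x ^ 2) :
    ∫ x, V x * u x ^ 2 ≤ ∫ x, ‖∇ u x‖ ^ 2 := by
  have hgcont : Continuous fun x => u x ^ 2 / w x :=
    continuous_sq_div hO hw.cont hw.pos hu.continuous hK
  have hgs : tsupport (fun x => u x ^ 2 / w x) ⊆ tsupport u := tsupport_sq_div
  have hgI : Integrable fun x => u x ^ 2 / w x := hgcont.integrable_of_hasCompactSupport
    (huc.of_isClosed_subset (isClosed_tsupport _) hgs)
  obtain ⟨M, h₁, h₁0, hM⟩ := hw.bdd _ hK huc.isCompact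
  obtain ⟨h₂, h₂0, hP⟩ := picone_secondDiff hO hw.cont hw.pos hu.continuous huc hK
  set c : ℝ := min (min (h₁ / 2) (h₂ / 2)) 1 with hc
  have hc0 : 0 < c := by positivity
  set h : ℕ → ℝ := fun n => c / (n + 1) with hh
  have hpos : ∀ n, 0 < h n := fun n => by positivity
  have hlec : ∀ n, h n ≤ c := fun n => div_le_self hc0.le (by simp)
  have hc1 : c ≤ h₁ / 2 := (min_le_left _ _).trans (min_le_left _ _)
  have hc2 : c ≤ h₂ / 2 := (min_le_left _ _).trans (min_le_right _ _)
  have hle : ∀ n, h n ≤ 1 := fun n => (hlec n).trans (min_le_right _ _)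
  have hlt1 : ∀ n, h n < h₁ := fun n => by linarith [hlec n]
  have hlt2 : ∀ n, h n < h₂ := fun n => by linarith [hlec n]
  have hlim : Tendsto h atTop (𝓝 0) := by
    have := (tendsto_one_div_add_atTop_nhds_zero_nat (𝕜 := ℝ)).const_mul c
    simpa [hh, div_eq_mul_inv] using this
  have hlim' : Tendsto h atTop (𝓝[>] 0) :=
    tendsto_nhdsWithin_iff.2 ⟨hlim, Eventually.of_forall hpos⟩
  set F : ℕ → Euc N → ℝ := fun n x =>
    M * (u x ^ 2 / w x) - u x ^ 2 / w x * secondDiff w x (h n) / h n ^ 2 with hF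
  have hg0 : ∀ x, 0 ≤ u x ^ 2 / w x := fun x => by
    by_cases hx : x ∈ tsupport u
    · have := hw.pos x (hK hx); positivity
    · simp [image_eq_zero_of_notMem_tsupport hx]
  have hF0 : ∀ n x, 0 ≤ F n x := fun n x => by
    by_cases hx : x ∈ tsupport u
    · have h1 := hM x hx (h n) (hpos n) (hlt1 n)
      have h2 : u x ^ 2 / w x * secondDiff w x (h n) / h n ^ 2 ≤ M * (u x ^ 2 / w x) := by
        rw [div_le_iff₀ (pow_pos (hpos n) 2)]
        nlinarith [mul_le_mul_of_nonneg_left h1 (hg0 x)]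
      simp only [hF]; linarith
    · simp [hF, image_eq_zero_of_notMem_tsupport hx]
  have hFI : ∀ n, Integrable (F n) := fun n =>
    (hgI.const_mul M).sub ((hP (h n) (hpos n) (hlt2 n)).1.div_const _)
  have hT := tendsto_integral_diff_sq hu huc hpos hle hlim
  have hFle : ∀ n, ∫ x, F n x ≤ M * (∫ x, u x ^ 2 / w x) +
      ∫ x, (∑ i, (u (x + h n • basisVec i) - u x) ^ 2) / h n ^ 2 := fun n => by
    have h1 := (hP (h n) (hpos n) (hlt2 n))
    rw [integral_sub (hgI.const_mul M) (h1.1.div_const _), integral_const_mul, integral_div,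
      integral_div, sub_eq_add_neg, ← neg_div]
    have := pow_pos (hpos n) 2
    gcongr
    exact h1.2
  have hlimG : Tendsto (fun n => ENNReal.ofReal (M * (∫ x, u x ^ 2 / w x) +
      ∫ x, (∑ i, (u (x + h n • basisVec i) - u x) ^ 2) / h n ^ 2)) atTop
      (𝓝 (ENNReal.ofReal (M * (∫ x, u x ^ 2 / w x) + ∫ x, ‖∇ u x‖ ^ 2))) :=
    ENNReal.tendsto_ofReal (hT.const_add _)
  have hfatou : ∫⁻ x, liminf (fun n => ENNReal.ofReal (F n x)) atTop ≤
      ENNReal.ofReal (M * (∫ x, u x ^ 2 / w x) + ∫ x, ‖∇ u x‖ ^ 2) := by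
    calc _ ≤ liminf (fun n => ∫⁻ x, ENNReal.ofReal (F n x)) atTop :=
          lintegral_liminf_le' fun n => (hFI n).aemeasurable.ennreal_ofReal
      _ ≤ liminf (fun n => ENNReal.ofReal (M * (∫ x, u x ^ 2 / w x) +
            ∫ x, (∑ i, (u (x + h n • basisVec i) - u x) ^ 2) / h n ^ 2)) atTop := by
          refine liminf_le_liminf (Eventually.of_forall fun n => ?_)
          rw [← ofReal_integral_eq_lintegral_ofReal (hFI n) (Eventually.of_forall (hF0 n))]
          exact ENNReal.ofReal_le_ofReal (hFle n)
      _ = _ := hlimG.liminf_eq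
  have hpt : ∀ᵐ x, ENNReal.ofReal (M * (u x ^ 2 / w x) + V x * u x ^ 2) ≤
      liminf (fun n => ENNReal.ofReal (F n x)) atTop := by
    filter_upwards [hw.lim] with x hx
    by_cases hxK : x ∈ tsupport u
    · have hwx := hw.pos x (hK hxK)
      refine ENNReal.le_of_forall_pos_le_add fun ε hε _ => ?_
      -- The tolerance gets multiplied by `u²/w`; the `+ 1` keeps the product below `ε` even where
      -- `u` vanishes.
      have hε' : 0 < (ε : ℝ) / (u x ^ 2 / w x + 1) := by
        have := hg0 x; positivity
      have h1 := hlim'.eventually (hx (hK hxK) _ hε')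
      have h2 : ∀ᶠ n in atTop, ENNReal.ofReal (M * (u x ^ 2 / w x) + V x * u x ^ 2 - ε) ≤
          ENNReal.ofReal (F n x) := by
        filter_upwards [h1] with n hn
        refine ENNReal.ofReal_le_ofReal ?_
        have h3 : u x ^ 2 / w x * secondDiff w x (h n) / h n ^ 2 ≤
            u x ^ 2 / w x * (-V x * w x + ε / (u x ^ 2 / w x + 1)) := by
          rw [div_le_iff₀ (pow_pos (hpos n) 2), mul_assoc]
          exact mul_le_mul_of_nonneg_left hn (hg0 x)
        have h4 : u x ^ 2 / w x * (ε / (u x ^ 2 / w x + 1)) ≤ ε := by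
          rw [mul_div_assoc', div_le_iff₀ (by linarith [hg0 x])]
          nlinarith [ε.coe_nonneg]
        have h5 : u x ^ 2 / w x * (-V x * w x) = - (V x * u x ^ 2) := by
          field_simp
        rw [mul_add, h5] at h3
        simp only [hF]
        linarith
      have h6 := le_liminf_of_le (by isBoundedDefault) h2
      calc ENNReal.ofReal (M * (u x ^ 2 / w x) + V x * u x ^ 2)
          = ENNReal.ofReal ((M * (u x ^ 2 / w x) + V x * u x ^ 2 - ε) + ε) := by ring_nf
        _ ≤ ENNReal.ofReal (M * (u x ^ 2 / w x) + V x * u x ^ 2 - ε) + ENNReal.ofReal ε :=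
          ENNReal.ofReal_add_le
        _ ≤ _ := by
          rw [ENNReal.ofReal_coe_nnreal]
          gcongr
    · simp [image_eq_zero_of_notMem_tsupport hxK]
  have hI : Integrable fun x => M * (u x ^ 2 / w x) + V x * u x ^ 2 := (hgI.const_mul M).add hV
  have hB : 0 ≤ M * (∫ x, u x ^ 2 / w x) + ∫ x, ‖∇ u x‖ ^ 2 := by
    refine ge_of_tendsto' (hT.const_add _) fun n => (integral_nonneg (hF0 n)).trans (hFle n)
  have hfin : ∫ x, (M * (u x ^ 2 / w x) + V x * u x ^ 2) ≤
      M * (∫ x, u x ^ 2 / w x) + ∫ x, ‖∇ u x‖ ^ 2 := by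
    have h1 := (lintegral_mono_ae hpt).trans hfatou
    have h2 : ENNReal.ofReal (∫ x, (M * (u x ^ 2 / w x) + V x * u x ^ 2)) ≤
        ∫⁻ x, ENNReal.ofReal (M * (u x ^ 2 / w x) + V x * u x ^ 2) := by
      -- No sign of the limiting integrand is needed: discarding its negative part only increases
      -- the bound.
      rw [integral_eq_lintegral_pos_part_sub_lintegral_neg_part hI]
      refine (ENNReal.ofReal_le_ofReal (sub_le_self _ ENNReal.toReal_nonneg)).trans ?_
      exact ENNReal.ofReal_toReal_le
    exact (ENNReal.ofReal_le_ofReal_iff hB).1 (h2.trans h1)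
  rw [integral_add (hgI.const_mul M) hV, integral_const_mul] at hfin
  linarith

end Picone

/-! ### Removing the origin -/

section Cutoff

variable {N : ℕ}

/-- A smooth bump function equal to `1` on the unit ball and supported in the ball of radius 2. -/
noncomputable def unitBump (N : ℕ) : ContDiffBump (0 : Euc N) := ⟨1, 2, one_pos, one_lt_two⟩

/-- A smooth function vanishing near the origin and equal to `1` off the ball of radius `2 / r`. -/
noncomputable def originCutoff (N : ℕ) (r : ℝ) (x : Euc N) : ℝ := 1 - unitBump N (r • x)

theorem contDiff_originCutoff (r : ℝ) : ContDiff ℝ 1 (originCutoff N r) :=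
  contDiff_const.sub ((unitBump N).contDiff.comp (contDiff_const_smul r))

theorem originCutoff_nonneg (r : ℝ) (x : Euc N) : 0 ≤ originCutoff N r x :=
  sub_nonneg.2 (unitBump N).le_one

theorem originCutoff_le_one (r : ℝ) (x : Euc N) : originCutoff N r x ≤ 1 :=
  sub_le_self _ (unitBump N).nonneg

theorem originCutoff_eq_zero {r : ℝ} {x : Euc N} (h : ‖r • x‖ ≤ 1) : originCutoff N r x = 0 := by
  rw [originCutoff, (unitBump N).one_of_mem_closedBall (by simpa [unitBump] using h), sub_self]

theorem originCutoff_eq_one {r : ℝ} {x : Euc N} (h : 2 ≤ ‖r • x‖) : originCutoff N r x = 1 := by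
  rw [originCutoff, (unitBump N).zero_of_le_dist (by simpa [unitBump] using h), sub_zero]

theorem exists_norm_fderiv_originCutoff_le (N : ℕ) :
    ∃ C : ℝ, 0 ≤ C ∧ ∀ r : ℝ, 0 ≤ r → ∀ x : Euc N, ‖fderiv ℝ (originCutoff N r) x‖ ≤ C * r := by
  have h1 : ContDiff ℝ 1 (unitBump N : Euc N → ℝ) := (unitBump N).contDiff
  obtain ⟨C, hC⟩ := h1.lipschitzWith_of_hasCompactSupport (unitBump N).hasCompactSupport one_ne_zero
  refine ⟨C, C.coe_nonneg, fun r hr x => ?_⟩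
  have h2 : LipschitzWith (C * r.toNNReal) (originCutoff N r) := by
    refine LipschitzWith.of_dist_le_mul fun x y => ?_
    have := hC.dist_le_mul (r • x) (r • y)
    rw [dist_smul₀, Real.norm_of_nonneg hr] at this
    simp only [originCutoff, NNReal.coe_mul, Real.coe_toNNReal r hr]
    rw [dist_sub_left, mul_assoc]
    exact this
  simpa [hr] using norm_fderiv_le_of_lipschitz ℝ (x₀ := x) h2

theorem norm_gradient_eq_norm_fderiv (u : Euc N → ℝ) (x : Euc N) : ‖∇ u x‖ = ‖fderiv ℝ u x‖ :=
  (InnerProductSpace.toDual ℝ (Euc N)).symm.norm_map _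

/-- The product agrees with `u` outside the ball of radius `2/r`. Inside, its gradient is `O(r)`, so
the extra energy is `r²` times the volume of that ball. -/
theorem integral_norm_gradient_sq_cutoff_le {u : Euc N → ℝ} (hu : ContDiff ℝ 1 u)
    (huc : HasCompactSupport u) : ∃ D : ℝ, ∀ r : ℝ, 1 ≤ r →
      ∫ x, ‖∇ (fun y => u y * originCutoff N r y) x‖ ^ 2
        ≤ (∫ x, ‖∇ u x‖ ^ 2) + D * r ^ 2 * (2 / r) ^ N := by
  obtain ⟨C, hC0, hC⟩ := exists_norm_fderiv_originCutoff_le N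
  obtain ⟨L, hL⟩ := hu.lipschitzWith_of_hasCompactSupport huc one_ne_zero
  obtain ⟨B, hB⟩ := huc.exists_bound_of_continuous hu.continuous
  have hB0 : 0 ≤ B := (norm_nonneg _).trans (hB 0)
  refine ⟨(L + B * C) ^ 2 * volume.real (Metric.ball (0 : Euc N) 1), fun r hr => ?_⟩
  have hr0 : 0 < r := by linarith
  have hI := integrable_norm_gradient_sq hu huc
  have hI2 : Integrable (Set.indicator (Metric.closedBall (0 : Euc N) (2 / r))
      fun _ => ((L + B * C) * r) ^ 2) := by
    rw [integrable_indicator_iff measurableSet_closedBall]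
    exact integrableOn_const measure_closedBall_lt_top.ne
  have hI3 : Integrable fun x => ‖∇ (fun y => u y * originCutoff N r y) x‖ ^ 2 :=
    integrable_norm_gradient_sq (hu.mul (contDiff_originCutoff r)) huc.mul_right
  calc ∫ x, ‖∇ (fun y => u y * originCutoff N r y) x‖ ^ 2
      ≤ ∫ x, (‖∇ u x‖ ^ 2 + Set.indicator (Metric.closedBall (0 : Euc N) (2 / r))
          (fun _ => ((L + B * C) * r) ^ 2) x) := by
        refine integral_mono hI3 (hI.add hI2) fun x => ?_
        by_cases hx : x ∈ Metric.closedBall (0 : Euc N) (2 / r)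
        · dsimp only
          rw [Set.indicator_of_mem hx]
          have h1 : ‖∇ (fun y => u y * originCutoff N r y) x‖ ≤ (L + B * C) * r := by
            rw [norm_gradient_eq_norm_fderiv, fderiv_fun_mul
              (hu.differentiable one_ne_zero _)
              ((contDiff_originCutoff r).differentiable one_ne_zero _)]
            refine (norm_add_le _ _).trans ?_
            rw [norm_smul, norm_smul]
            have e1 := hB x
            have e2 := hC r hr0.le x
            have e3 : ‖fderiv ℝ u x‖ ≤ L := norm_fderiv_le_of_lipschitz ℝ hL
            have e4 : ‖originCutoff N r x‖ ≤ 1 := by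
              rw [Real.norm_of_nonneg (originCutoff_nonneg _ _)]
              exact originCutoff_le_one _ _
            calc ‖u x‖ * ‖fderiv ℝ (originCutoff N r) x‖ + ‖originCutoff N r x‖ * ‖fderiv ℝ u x‖
                ≤ B * (C * r) + 1 * L := by gcongr
              _ ≤ (L + B * C) * r := by nlinarith [L.coe_nonneg]
          have h2 : ‖∇ (fun y => u y * originCutoff N r y) x‖ ^ 2 ≤ ((L + B * C) * r) ^ 2 := by
            gcongr
          linarith [sq_nonneg ‖∇ u x‖]
        · dsimp only
          rw [Set.indicator_of_notMem hx, add_zero]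
          have h1 : (fun y => u y * originCutoff N r y) =ᶠ[𝓝 x] u := by
            filter_upwards [Metric.isClosed_closedBall.isOpen_compl.mem_nhds hx] with y hy
            rw [originCutoff_eq_one, mul_one]
            rw [Set.mem_compl_iff, mem_closedBall_zero_iff, not_le, div_lt_iff₀ hr0] at hy
            rw [norm_smul, Real.norm_of_nonneg hr0.le, mul_comm]
            exact hy.le
          rw [norm_gradient_eq_norm_fderiv, norm_gradient_eq_norm_fderiv, h1.fderiv_eq]
    _ = _ := by
        rw [integral_add hI hI2, integral_indicator measurableSet_closedBall, setIntegral_const,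
          Measure.addHaar_real_closedBall _ _ (by positivity)]
        simp only [finrank_euclideanSpace, Fintype.card_fin, smul_eq_mul]
        ring

theorem tsupport_mul_originCutoff_subset {O : Set (Euc N)} {u : Euc N → ℝ} {r : ℝ}
    (hK : tsupport u ⊆ O) :
    tsupport (fun y => u y * originCutoff N r y) ⊆ O \ {0} := by
  intro x hx
  refine ⟨hK (tsupport_mul_subset_left hx), ?_⟩
  rintro rfl
  have h1 : (fun y => u y * originCutoff N r y) =ᶠ[𝓝 0] 0 := by
    have : ∀ᶠ y : Euc N in 𝓝 0, ‖r • y‖ < 1 := by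
      have hc : ContinuousAt (fun y : Euc N => ‖r • y‖) 0 := by fun_prop
      exact hc.eventually_lt continuousAt_const (by simp)
    filter_upwards [this] with y hy
    simp [originCutoff_eq_zero hy.le]
  exact (notMem_tsupport_iff_eventuallyEq.2 h1) hx

/-- In dimension at least three, a supersolution off the origin suffices. -/
theorem IsSupersolution.integral_le_of_diff_zero {O : Set (Euc N)} {w V u : Euc N → ℝ}
    (hN : 3 ≤ N) (hw : IsSupersolution (O \ {0}) w V) (hO : IsOpen O)
    (hu : ContDiff ℝ 1 u) (huc : HasCompactSupport u) (hK : tsupport u ⊆ O)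
    (hV : Integrable fun x => V x * u x ^ 2) :
    ∫ x, V x * u x ^ 2 ≤ ∫ x, ‖∇ u x‖ ^ 2 := by
  have : Nonempty (Fin N) := ⟨⟨0, by omega⟩⟩
  obtain ⟨D, hD⟩ := integral_norm_gradient_sq_cutoff_le hu huc
  set f : ℕ → Euc N → ℝ := fun n x => V x * (u x * originCutoff N (n + 1) x) ^ 2 with hf
  have hmeas : ∀ n, AEStronglyMeasurable (f n) volume := fun n => by
    have h1 : AEStronglyMeasurable (fun x => V x * u x ^ 2 * originCutoff N (n + 1) x ^ 2)
        volume :=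
      hV.aestronglyMeasurable.mul
        ((contDiff_originCutoff _).continuous.pow 2).aestronglyMeasurable
    refine h1.congr (Eventually.of_forall fun x => ?_)
    simp only [hf]; ring
  have hbound : ∀ n x, ‖f n x‖ ≤ ‖V x * u x ^ 2‖ := fun n x => by
    have h1 : f n x = V x * u x ^ 2 * originCutoff N (n + 1) x ^ 2 := by simp only [hf]; ring
    rw [h1, norm_mul]
    refine mul_le_of_le_one_right (norm_nonneg _) ?_
    rw [Real.norm_of_nonneg (sq_nonneg _)]
    exact pow_le_one₀ (originCutoff_nonneg _ _) (originCutoff_le_one _ _)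
  have hle : ∀ n : ℕ, ∫ x, f n x ≤ (∫ x, ‖∇ u x‖ ^ 2) + D * ((n + 1 : ℝ) ^ 2 *
      (2 / (n + 1 : ℝ)) ^ N) := fun n => by
    have h1 := hw.integral_le (hO.sdiff isClosed_singleton)
      (hu.mul (contDiff_originCutoff (n + 1))) huc.mul_right (tsupport_mul_originCutoff_subset hK)
      (hV.mono (hmeas n) (Eventually.of_forall (hbound n)))
    have h2 := h1.trans (hD (n + 1) (by simp))
    rwa [mul_assoc] at h2
  have hlim1 : Tendsto (fun n => ∫ x, f n x) atTop (𝓝 (∫ x, V x * u x ^ 2)) := by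
    refine tendsto_integral_of_dominated_convergence (fun x => ‖V x * u x ^ 2‖) hmeas hV.norm
      (fun n => Eventually.of_forall (hbound n)) ?_
    filter_upwards [Measure.ae_ne volume (0 : Euc N)] with x hx
    refine tendsto_const_nhds.congr' ?_
    obtain ⟨n₀, hn₀⟩ := exists_nat_ge (2 / ‖x‖)
    filter_upwards [eventually_ge_atTop n₀] with n hn
    simp only [hf]
    rw [originCutoff_eq_one, mul_one]
    have h1 : (n₀ : ℝ) ≤ n + 1 := by
      have : (n₀ : ℝ) ≤ n := by exact_mod_cast hn
      linarith
    rw [norm_smul, Real.norm_of_nonneg (by positivity)]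
    exact (div_le_iff₀ (norm_pos_iff.2 hx)).1 (hn₀.trans h1)
  -- This is where `N ≥ 3` makes the cutoff cost vanish: the expression is at most `2^N/(n+1)`.
  have hlim2 : Tendsto (fun n : ℕ => (n + 1 : ℝ) ^ 2 * (2 / (n + 1 : ℝ)) ^ N) atTop (𝓝 0) := by
    have h0 := (tendsto_one_div_add_atTop_nhds_zero_nat (𝕜 := ℝ)).const_mul (2 ^ N)
    rw [mul_zero] at h0
    refine squeeze_zero (fun n => by positivity) (fun n => ?_) h0
    have h1 : (1 : ℝ) ≤ n + 1 := by simp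
    obtain ⟨k, rfl⟩ := Nat.exists_eq_add_of_le hN
    rw [div_pow, pow_add (n + 1 : ℝ) 3 k, mul_div_assoc', mul_one_div,
      div_le_div_iff₀ (by positivity) (by positivity)]
    have h2 : 1 ≤ (n + 1 : ℝ) ^ k := one_le_pow₀ h1
    have h3 : (0 : ℝ) ≤ (n + 1) ^ 3 * 2 ^ (3 + k) := by positivity
    nlinarith [mul_le_mul_of_nonneg_left h2 h3]
  have hlim3 := (hlim2.const_mul D).const_add (∫ x, ‖∇ u x‖ ^ 2)
  rw [mul_zero, add_zero] at hlim3
  exact le_of_tendsto_of_tendsto' hlim1 hlim3 hle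

end Cutoff

/-- `g` is twice differentiable at `0` with value `a`, first derivative `b` and second
derivative `c`. -/
def HasJet (g : ℝ → ℝ) (a b c : ℝ) : Prop :=
  ∃ g' : ℝ → ℝ, (∀ᶠ t in 𝓝 0, HasDerivAt g (g' t) t) ∧ HasDerivAt g' c 0 ∧ g' 0 = b ∧ g 0 = a

/-! ### Calculus of pointwise second-order jets on the line -/

namespace HasJet

variable {g k : ℝ → ℝ} {a b c a' b' c' : ℝ}

theorem continuousAt (hg : HasJet g a b c) : ContinuousAt g 0 := by
  obtain ⟨g', h, -⟩ := hg
  exact h.self_of_nhds.continuousAt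

theorem const (a : ℝ) : HasJet (fun _ => a) a 0 0 :=
  ⟨fun _ => 0, Eventually.of_forall fun t => hasDerivAt_const t a, hasDerivAt_const _ _, rfl, rfl⟩

theorem sub (hg : HasJet g a b c) (hk : HasJet k a' b' c') :
    HasJet (fun t => g t - k t) (a - a') (b - b') (c - c') := by
  obtain ⟨g', h1, h2, h3, h4⟩ := hg
  obtain ⟨k', k1, k2, k3, k4⟩ := hk
  refine ⟨fun t => g' t - k' t, ?_, h2.fun_sub k2, by simp [h3, k3], by simp [h4, k4]⟩
  filter_upwards [h1, k1] with t ht kt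
  exact ht.fun_sub kt

theorem mul (hg : HasJet g a b c) (hk : HasJet k a' b' c') :
    HasJet (fun t => g t * k t) (a * a') (b * a' + a * b') (c * a' + 2 * b * b' + a * c') := by
  obtain ⟨g', h1, h2, h3, h4⟩ := hg
  obtain ⟨k', k1, k2, k3, k4⟩ := hk
  refine ⟨fun t => g' t * k t + g t * k' t, ?_, ?_, by simp [h3, h4, k3, k4], by simp [h4, k4]⟩
  · filter_upwards [h1, k1] with t ht kt
    exact ht.fun_mul kt
  · refine ((h2.fun_mul k1.self_of_nhds).fun_add (h1.self_of_nhds.fun_mul k2)).congr_deriv ?_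
    rw [h3, h4, k3, k4]; ring

theorem comp {φ φ' : ℝ → ℝ} {d : ℝ} (hg : HasJet g a b c)
    (h1 : ∀ᶠ y in 𝓝 a, HasDerivAt φ (φ' y) y) (h2 : HasDerivAt φ' d a) :
    HasJet (fun t => φ (g t)) (φ a) (φ' a * b) (d * b ^ 2 + φ' a * c) := by
  have hc := hg.continuousAt
  obtain ⟨g', g1, g2, g3, g4⟩ := hg
  subst g4
  refine ⟨fun t => φ' (g t) * g' t, ?_, ?_, by simp [g3], rfl⟩
  · filter_upwards [g1, hc.eventually h1] with t ht kt
    exact kt.comp t ht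
  · refine ((h2.comp 0 g1.self_of_nhds).fun_mul g2).congr_deriv ?_
    simp only [Function.comp, g3]; ring

theorem rpow (hg : HasJet g a b c) (ha : 0 < a) (p : ℝ) :
    HasJet (fun t => g t ^ p) (a ^ p) (p * a ^ (p - 1) * b)
      (p * ((p - 1) * a ^ (p - 1 - 1)) * b ^ 2 + p * a ^ (p - 1) * c) := by
  refine hg.comp (φ := fun y => y ^ p) (φ' := fun y => p * y ^ (p - 1)) ?_ ?_
  · filter_upwards [lt_mem_nhds ha] with y hy
    exact Real.hasDerivAt_rpow_const (Or.inl hy.ne')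
  · exact (Real.hasDerivAt_rpow_const (Or.inl ha.ne')).const_mul p

theorem sqrt (hg : HasJet g a b c) (ha : 0 < a) :
    HasJet (fun t => √(g t)) (√a) (b / (2 * √a)) (c / (2 * √a) - b ^ 2 / (4 * a * √a)) := by
  have h1 : ∀ᶠ y in 𝓝 a, HasDerivAt (fun y => √y) (1 / (2 * √y)) y := by
    filter_upwards [lt_mem_nhds ha] with y hy
    exact Real.hasDerivAt_sqrt hy.ne'
  have hs : 0 < √a := Real.sqrt_pos.2 ha
  have hs2 : √a ^ 2 = a := Real.sq_sqrt ha.le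
  have h2 : HasDerivAt (fun y => 1 / (2 * √y)) (-1 / (4 * a * √a)) a := by
    refine ((hasDerivAt_const a (1 : ℝ)).fun_div
      ((Real.hasDerivAt_sqrt ha.ne').const_mul 2) (by positivity)).congr_deriv ?_
    nth_rewrite 4 [← hs2]
    field_simp
    ring
  convert hg.comp (φ := fun y => √y) h1 h2 using 1
  · ring
  · ring

/-- One application of L'Hôpital leaves `(g'(h) - g'(-h))/(2h)`, whose limit needs only
differentiability of `g'` at the single point `0`. -/
theorem tendsto_secondDiff (hg : HasJet g a b c) :
    Tendsto (fun h => (g h + g (-h) - 2 * g 0) / h ^ 2) (𝓝[>] 0) (𝓝 c) := by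
  obtain ⟨g', g1, g2, g3, g4⟩ := hg
  have hneg : Tendsto (fun h : ℝ => -h) (𝓝 0) (𝓝 0) := by simpa using (continuous_neg (G := ℝ)).tendsto 0
  have g1' : ∀ᶠ h in 𝓝 (0 : ℝ), HasDerivAt (fun h => g (-h)) (-g' (-h)) h := by
    filter_upwards [hneg.eventually g1] with h hh
    simpa [Function.comp_def] using hh.comp h (hasDerivAt_neg h)
  have g2' : HasDerivAt (fun h => g' h - g' (-h)) (2 * c) 0 := by
    have h0 : HasDerivAt g' c (-0) := by simpa using g2
    refine (g2.fun_sub (h0.scomp (0 : ℝ) (hasDerivAt_neg 0))).congr_deriv ?_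
    simp; ring
  refine HasDerivAt.lhopital_zero_nhdsGT (f' := fun h => g' h - g' (-h))
    (g' := fun h : ℝ => 2 * h) ?_ ?_ ?_ ?_ ?_ ?_
  · refine nhdsWithin_le_nhds ?_
    filter_upwards [g1, g1'] with h h1 h2
    simpa [sub_eq_add_neg] using (h1.fun_add h2).sub_const (2 * g 0)
  · refine Eventually.of_forall fun h => ?_
    simpa using hasDerivAt_pow 2 h
  · filter_upwards [self_mem_nhdsWithin] with h hh
    simpa using (ne_of_gt hh)
  · have hc : ContinuousAt g 0 := g1.self_of_nhds.continuousAt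
    have h1 : Tendsto g (𝓝 0) (𝓝 (g 0)) := hc
    have h2 := (h1.add (h1.comp hneg)).sub_const (2 * g 0)
    have h3 : g 0 + g 0 - 2 * g 0 = 0 := by ring
    rw [h3] at h2
    exact h2.mono_left nhdsWithin_le_nhds
  · have : Tendsto (fun h : ℝ => h ^ 2) (𝓝 0) (𝓝 (0 ^ 2)) := (continuous_pow 2).tendsto 0
    rw [zero_pow two_ne_zero] at this
    exact this.mono_left nhdsWithin_le_nhds
  · have h1 := (g2'.tendsto_slope_zero_right).const_mul (1 / 2)
    have h2 : 1 / 2 * (2 * c) = c := by ring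
    rw [h2] at h1
    refine h1.congr fun h => ?_
    simp
    ring

end HasJet

/-! ### The Hardy ground state and touching from above -/

section Radial

variable {N : ℕ}

theorem tendsto_secondDiff_div {w : Euc N → ℝ} {x : Euc N} {a : ℝ} {b c : Fin N → ℝ}
    (hw : ∀ i, HasJet (fun t => w (x + t • basisVec i)) a (b i) (c i)) :
    Tendsto (fun h => secondDiff w x h / h ^ 2) (𝓝[>] 0) (𝓝 (∑ i, c i)) := by
  simp_rw [secondDiff, Finset.sum_div]
  refine tendsto_finsetSum _ fun i _ => ?_
  refine (hw i).tendsto_secondDiff.congr fun h => ?_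
  simp [sub_eq_add_neg]

theorem norm_add_smul_basisVec_sq (y : Euc N) (t : ℝ) (i : Fin N) :
    ‖y + t • basisVec i‖ ^ 2 = ‖y‖ ^ 2 + 2 * t * y i + t ^ 2 := by
  rw [norm_add_sq_real, norm_smul_basisVec, sq_abs, inner_smul_right,
    EuclideanSpace.inner_single_right]
  simp; ring

theorem hasJet_norm_sq (y : Euc N) (i : Fin N) :
    HasJet (fun t => ‖y + t • basisVec i‖ ^ 2) (‖y‖ ^ 2) (2 * y i) 2 := by
  simp_rw [norm_add_smul_basisVec_sq]
  refine ⟨fun t => 2 * y i + 2 * t, Eventually.of_forall fun t => ?_, ?_, by simp, by simp⟩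
  · have h1 := ((((hasDerivAt_id t).const_mul 2).mul_const (y i)).const_add (‖y‖ ^ 2)).fun_add
      (hasDerivAt_pow 2 t)
    refine h1.congr_deriv ?_
    simp
  · simpa using ((hasDerivAt_id (0 : ℝ)).const_mul 2).const_add (2 * y i)

theorem hasJet_norm_rpow {y : Euc N} (hy : y ≠ 0) (q : ℝ) (i : Fin N) :
    HasJet (fun t => ‖y + t • basisVec i‖ ^ q) (‖y‖ ^ q) (‖y‖ ^ q * (q * y i / ‖y‖ ^ 2))
      (‖y‖ ^ q * (q * (q - 2) * y i ^ 2 / ‖y‖ ^ 4 + q / ‖y‖ ^ 2)) := by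
  have hn : 0 < ‖y‖ := norm_pos_iff.2 hy
  have h0 : ∀ s : ℝ, 0 ≤ s → (s ^ 2) ^ (q / 2) = s ^ q := fun s hs => by
    rw [← Real.rpow_natCast, ← Real.rpow_mul hs]
    congr 1; push_cast; ring
  have h1 := (hasJet_norm_sq y i).rpow (by positivity) (q / 2)
  have h2 : (‖y‖ ^ 2) ^ (q / 2 - 1) = ‖y‖ ^ q / ‖y‖ ^ 2 := by
    rw [Real.rpow_sub_one (by positivity), h0 _ hn.le]
  have h3 : (‖y‖ ^ 2) ^ (q / 2 - 1 - 1) = ‖y‖ ^ q / ‖y‖ ^ 4 := by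
    rw [Real.rpow_sub_one (by positivity), h2]; field_simp
  rw [h2, h3, h0 _ hn.le] at h1
  simp_rw [h0 _ (norm_nonneg _)] at h1
  convert h1 using 1
  · ring
  · ring

/-- The Hardy ground state `|x|^{-(N-2)/2}`. -/
noncomputable def hardyWeight (N : ℕ) (x : Euc N) : ℝ := ‖x‖ ^ (-(((N : ℝ) - 2) / 2))

theorem hardyWeight_pos {x : Euc N} (hx : x ≠ 0) : 0 < hardyWeight N x :=
  Real.rpow_pos_of_pos (norm_pos_iff.2 hx) _

theorem sum_sq_eq_norm_sq (x : Euc N) : ∑ i, x i ^ 2 = ‖x‖ ^ 2 := by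
  simp [EuclideanSpace.norm_sq_eq]

/-- The product rule `Δ(φg) = gΔφ + 2∇φ·∇g + φΔg` for `φ = |x|^{-(N-2)/2}`, where `Δφ =
-(N-2)²/(4|x|²) φ` and `2∇φ = -(N-2) φ x/|x|²`. The arrays `b`, `c` stand for the first and pure
second partial derivatives of `g`. -/
theorem tendsto_secondDiff_hardyWeight_mul {g : Euc N → ℝ} {x : Euc N} (hx : x ≠ 0) {a : ℝ}
    {b c : Fin N → ℝ} (hg : ∀ i, HasJet (fun t => g (x + t • basisVec i)) a (b i) (c i)) :
    Tendsto (fun h => secondDiff (fun y => hardyWeight N y * g y) x h / h ^ 2) (𝓝[>] 0)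
      (𝓝 (hardyWeight N x * (-(((N : ℝ) - 2) ^ 2 / (4 * ‖x‖ ^ 2)) * a
        - ((N : ℝ) - 2) * (∑ i, x i * b i) / ‖x‖ ^ 2 + ∑ i, c i))) := by
  have hn : 0 < ‖x‖ := norm_pos_iff.2 hx
  have h1 := tendsto_secondDiff_div (w := fun y => hardyWeight N y * g y) (x := x)
    fun i => (hasJet_norm_rpow hx (-(((N : ℝ) - 2) / 2)) i).mul (hg i)
  convert h1 using 2
  rw [hardyWeight]
  set q := -(((N : ℝ) - 2) / 2) with hq
  have e : ∀ i, ‖x‖ ^ q * (q * (q - 2) * x i ^ 2 / ‖x‖ ^ 4 + q / ‖x‖ ^ 2) * a +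
      2 * (‖x‖ ^ q * (q * x i / ‖x‖ ^ 2)) * b i + ‖x‖ ^ q * c i =
      ‖x‖ ^ q * (q * (q - 2) * a / ‖x‖ ^ 4 * x i ^ 2 + q / ‖x‖ ^ 2 * a +
        2 * q / ‖x‖ ^ 2 * (x i * b i) + c i) := fun i => by ring
  simp_rw [e]
  rw [← Finset.mul_sum]
  congr 1
  simp only [Finset.sum_add_distrib, ← Finset.mul_sum, sum_sq_eq_norm_sq, Finset.sum_const,
    Finset.card_univ, Fintype.card_fin, nsmul_eq_mul]
  rw [hq]
  field_simp
  ring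

theorem eventually_secondDiff_le_of_tendsto {w : Euc N → ℝ} {x : Euc N} {l m : ℝ}
    (h : Tendsto (fun h => secondDiff w x h / h ^ 2) (𝓝[>] 0) (𝓝 l)) (hl : l ≤ m) {ε : ℝ}
    (hε : 0 < ε) : ∀ᶠ h in 𝓝[>] (0 : ℝ), secondDiff w x h ≤ (m + ε) * h ^ 2 := by
  filter_upwards [h.eventually (gt_mem_nhds (show l < m + ε by linarith)), self_mem_nhdsWithin]
    with t ht ht0
  exact (div_le_iff₀ (pow_pos ht0 2)).1 ht.le

/-- Only the neighbouring values enter a second difference with a plus sign, so a majorant with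
equality at the centre has the larger one. -/
theorem secondDiff_le_of_touching {w W : Euc N → ℝ} {x : Euc N} {h : ℝ} (hx : w x = W x)
    (h1 : ∀ i, w (x + h • basisVec i) ≤ W (x + h • basisVec i))
    (h2 : ∀ i, w (x - h • basisVec i) ≤ W (x - h • basisVec i)) :
    secondDiff w x h ≤ secondDiff W x h := by
  refine Finset.sum_le_sum fun i _ => ?_
  rw [hx]
  linarith [h1 i, h2 i]

theorem secondDiff_le_of_touching_on {O : Set (Euc N)} {w W : Euc N → ℝ} {x : Euc N} {h δ : ℝ}
    (hO : Metric.cthickening δ {x} ⊆ O) (h0 : 0 < h) (hδ : h ≤ δ) (hx : w x = W x)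
    (hle : ∀ y ∈ O, w y ≤ W y) :
    secondDiff w x h ≤ secondDiff W x h := by
  have hmem : ∀ y, ‖y - x‖ ≤ δ → y ∈ O := fun y hy =>
    hO (Metric.mem_cthickening_of_dist_le _ x _ _ rfl (by rwa [dist_eq_norm]))
  refine secondDiff_le_of_touching hx (fun i => hle _ (hmem _ ?_)) (fun i => hle _ (hmem _ ?_))
  · rwa [add_sub_cancel_left, norm_smul_basisVec, abs_of_pos h0]
  · rwa [sub_sub_cancel_left, norm_neg, norm_smul_basisVec, abs_of_pos h0]

theorem eventually_secondDiff_le_of_touching {O : Set (Euc N)} (hO : IsOpen O) {w W : Euc N → ℝ}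
    {x : Euc N} (hxO : x ∈ O) (hx : w x = W x) (hle : ∀ y ∈ O, w y ≤ W y) :
    ∀ᶠ h in 𝓝[>] (0 : ℝ), secondDiff w x h ≤ secondDiff W x h := by
  obtain ⟨δ, hδ, hsub⟩ := isCompact_singleton.exists_cthickening_subset_open hO
    (Set.singleton_subset_iff.2 hxO)
  filter_upwards [Ioc_mem_nhdsGT hδ] with h hh
  exact secondDiff_le_of_touching_on hsub hh.1 hh.2 hx hle

end Radial

/-! ### Uniform second-order bounds on compact sets -/

section Taylor

variable {G : Type*} [NormedAddCommGroup G] [NormedSpace ℝ G]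

theorem ContDiffAt.exists_taylor_bound {f : G → ℝ} {p₀ : G} (hf : ContDiffAt ℝ 2 f p₀) :
    ∃ L : ℝ, 0 ≤ L ∧ ∃ ρ > 0, ∀ p ∈ Metric.ball p₀ ρ, ∀ y ∈ Metric.ball p₀ ρ,
      |f y - f p - fderiv ℝ f p (y - p)| ≤ L * ‖y - p‖ ^ 2 := by
  have h1 : ContDiffAt ℝ 1 (fderiv ℝ f) p₀ := hf.fderiv_right (by norm_num)
  have h2 : ∀ᶠ y in 𝓝 p₀, DifferentiableAt ℝ f y := by
    filter_upwards [hf.eventually (by simp)] with y hy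
    exact hy.differentiableAt two_ne_zero
  have h3 : ∃ K : NNReal, ∃ t ∈ 𝓝 p₀, LipschitzOnWith K (fderiv ℝ f) t := h1.exists_lipschitzOnWith
  obtain ⟨K, t, ht, hK⟩ := h3
  obtain ⟨ρ, hρ, hsub⟩ := Metric.mem_nhds_iff.1 (Filter.inter_mem ht h2)
  refine ⟨K, K.coe_nonneg, ρ, hρ, fun p hp y hy => ?_⟩
  -- Intersecting with the ball of radius `‖y - p‖` about `p` keeps the variation of the derivative
  -- at most `K ‖y - p‖` on the convex set used for the mean value inequality.
  have hs : Convex ℝ (Metric.ball p₀ ρ ∩ Metric.closedBall p ‖y - p‖) :=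
    (convex_ball _ _).inter (convex_closedBall _ _)
  have h4 := hs.norm_image_sub_le_of_norm_fderiv_le' (𝕜 := ℝ) (f := f) (φ := fderiv ℝ f p)
    (C := K * ‖y - p‖) (x := p) (y := y) (fun z hz => (hsub hz.1).2) (fun z hz => by
      have h5 := hK.dist_le_mul z (hsub hz.1).1 p (hsub hp).1
      rw [dist_eq_norm] at h5
      refine h5.trans ?_
      gcongr
      exact hz.2) ⟨hp, by simp⟩ ⟨hy, by simp [dist_eq_norm]⟩
  rw [Real.norm_eq_abs] at h4
  rw [pow_two, ← mul_assoc]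
  exact h4

/-- In a symmetric difference the linear Taylor terms cancel; the local constants are patched by
compactness. -/
theorem exists_secondDiff_bound {f : G → ℝ} {S K : Set G} (hf : ∀ p ∈ S, ContDiffAt ℝ 2 f p)
    (hK : IsCompact K) (hKS : K ⊆ S) :
    ∃ M : ℝ, ∃ h₀ > 0, ∀ p ∈ K, ∀ v : G, ‖v‖ < h₀ → f (p + v) + f (p - v) - 2 * f p
      ≤ M * ‖v‖ ^ 2 := by
  refine hK.induction_on (p := fun K => ∃ M : ℝ, ∃ h₀ > 0, ∀ p ∈ K, ∀ v : G, ‖v‖ < h₀ →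
    f (p + v) + f (p - v) - 2 * f p ≤ M * ‖v‖ ^ 2) ⟨0, 1, one_pos, by simp⟩ ?_ ?_ ?_
  · rintro s t hst ⟨M, h₀, h0, H⟩
    exact ⟨M, h₀, h0, fun p hp => H p (hst hp)⟩
  · rintro s t ⟨M, h₀, h0, H⟩ ⟨M', h₀', h0', H'⟩
    refine ⟨max M M', min h₀ h₀', lt_min h0 h0', fun p hp v hv => ?_⟩
    rcases hp with hp | hp
    · refine (H p hp v (hv.trans_le (min_le_left _ _))).trans ?_
      gcongr; exact le_max_left _ _
    · refine (H' p hp v (hv.trans_le (min_le_right _ _))).trans ?_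
      gcongr; exact le_max_right _ _
  · intro p₀ hp₀
    obtain ⟨L, hL, ρ, hρ, H⟩ := (hf p₀ (hKS hp₀)).exists_taylor_bound
    refine ⟨Metric.ball p₀ (ρ / 2), mem_nhdsWithin_of_mem_nhds (Metric.ball_mem_nhds _ (by positivity)),
      2 * L, ρ / 2, by positivity, fun p hp v hv => ?_⟩
    rw [mem_ball_iff_norm] at hp
    have m0 : p ∈ Metric.ball p₀ ρ := by rw [mem_ball_iff_norm]; linarith
    have m1 : p + v ∈ Metric.ball p₀ ρ := by
      rw [mem_ball_iff_norm, add_sub_right_comm]; linarith [norm_add_le (p - p₀) v]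
    have m2 : p - v ∈ Metric.ball p₀ ρ := by
      rw [mem_ball_iff_norm, sub_right_comm]; linarith [norm_sub_le (p - p₀) v]
    have e1 := (abs_le.1 (H p m0 _ m1)).2
    have e2 := (abs_le.1 (H p m0 _ m2)).2
    rw [add_sub_cancel_left] at e1
    rw [sub_sub_cancel_left, map_neg, norm_neg] at e2
    linarith

theorem exists_bound_secondDiff {N : ℕ} {w : Euc N → ℝ} {S K : Set (Euc N)}
    (hf : ∀ p ∈ S, ContDiffAt ℝ 2 w p) (hK : IsCompact K) (hKS : K ⊆ S) :
    ∃ M : ℝ, ∃ h₀ > 0, ∀ p ∈ K, ∀ h, 0 < h → h < h₀ → secondDiff w p h ≤ M * h ^ 2 := by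
  obtain ⟨M, h₀, h0, H⟩ := exists_secondDiff_bound hf hK hKS
  refine ⟨N * M, h₀, h0, fun p hp h hh hh' => ?_⟩
  have : ∀ i ∈ Finset.univ, w (p + h • basisVec i) + w (p - h • basisVec i) - 2 * w p
      ≤ M * h ^ 2 := fun i _ => by
    have := H p hp (h • basisVec i) (by rwa [norm_smul_basisVec, abs_of_pos hh])
    rwa [norm_smul_basisVec, sq_abs] at this
  refine (Finset.sum_le_sum this).trans_eq ?_
  simp; ring

/-- Uniform second difference bounds for a `C²` family of functions. -/
theorem exists_bound_secondDiff_family {N : ℕ} {Φ : Euc N × Euc N → ℝ} {S K : Set (Euc N × Euc N)}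
    (hf : ∀ p ∈ S, ContDiffAt ℝ 2 Φ p) (hK : IsCompact K) (hKS : K ⊆ S) :
    ∃ M : ℝ, ∃ h₀ > 0, ∀ x z, (x, z) ∈ K → ∀ h, 0 < h → h < h₀ →
      secondDiff (fun y => Φ (y, z)) x h ≤ M * h ^ 2 := by
  obtain ⟨M, h₀, h0, H⟩ := exists_secondDiff_bound hf hK hKS
  refine ⟨N * M, h₀, h0, fun x z hp h hh hh' => ?_⟩
  have : ∀ i ∈ Finset.univ, Φ (x + h • basisVec i, z) + Φ (x - h • basisVec i, z) - 2 * Φ (x, z)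
      ≤ M * h ^ 2 := fun i _ => by
    have hn : ‖((h • basisVec i : Euc N), (0 : Euc N))‖ = h := by
      rw [Prod.norm_mk, norm_smul_basisVec, norm_zero, abs_of_pos hh, max_eq_left hh.le]
    have := H (x, z) hp (h • basisVec i, 0) (by rwa [hn])
    rwa [hn, Prod.mk_add_mk, Prod.mk_sub_mk, add_zero, sub_zero] at this
  refine (Finset.sum_le_sum this).trans_eq ?_
  simp; ring

end Taylor

/-! ### Boundary distance and the exterior ball condition -/

section BoundaryDistance

variable {N : ℕ} {Ω : Set (Euc N)}

/-- The segment from `x` to `z` meets the frontier at some `q`. By closedness `‖q - z‖ ≥ r`, and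
distances add along the segment. -/
theorem bdryDist_le_of_disjoint_ball (hΩ : IsOpen Ω) {x z : Euc N} {r : ℝ} (hx : x ∈ Ω)
    (hz : z ∉ Ω) (hr : ∀ y ∈ Ω, r ≤ ‖y - z‖) : bdryDist Ω x ≤ ‖x - z‖ - r := by
  obtain ⟨q, hq, hqf⟩ : (segment ℝ x z ∩ frontier Ω).Nonempty := by
    by_contra hempty
    have hfr : ∀ q ∈ segment ℝ x z, q ∉ frontier Ω := fun q h1 h2 => hempty ⟨q, h1, h2⟩
    have hcl : ∀ q ∈ segment ℝ x z, q ∉ Ω → q ∉ closure Ω := fun q h1 h2 h3 =>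
      hfr q h1 (by rw [hΩ.frontier_eq]; exact ⟨h3, h2⟩)
    obtain ⟨q, -, h1, h2⟩ := (convex_segment (𝕜 := ℝ) x z).isPreconnected Ω (closure Ω)ᶜ hΩ
      isClosed_closure.isOpen_compl (fun q hq => or_iff_not_imp_left.2 (hcl q hq))
      ⟨x, left_mem_segment _ _ _, hx⟩
      ⟨z, right_mem_segment _ _ _, hcl z (right_mem_segment _ _ _) hz⟩
    exact h2 (subset_closure h1)
  have h1 : r ≤ ‖q - z‖ := by
    have hcl : IsClosed {y : Euc N | r ≤ ‖y - z‖} := isClosed_le continuous_const (by fun_prop)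
    exact closure_minimal hr hcl hqf.1
  have h2 := dist_add_dist_of_mem_segment hq
  have h3 : bdryDist Ω x ≤ dist x q := Metric.infDist_le_dist_of_mem hqf
  rw [dist_eq_norm q z, dist_eq_norm x z] at h2
  linarith

theorem bdryDist_le_norm_sub (hΩ : IsOpen Ω) {x z : Euc N} (hx : x ∈ Ω) (hz : z ∉ Ω) :
    bdryDist Ω x ≤ ‖x - z‖ := by
  simpa using bdryDist_le_of_disjoint_ball (r := 0) hΩ hx hz fun y _ => norm_nonneg _

theorem mem_of_norm_sub_lt_bdryDist (hΩ : IsOpen Ω) {x y : Euc N} (hx : x ∈ Ω)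
    (h : ‖x - y‖ < bdryDist Ω x) : y ∈ Ω := by
  by_contra hy
  exact (bdryDist_le_norm_sub hΩ hx hy).not_gt h

theorem lipschitzWith_bdryDist : LipschitzWith 1 (bdryDist Ω) :=
  Metric.lipschitz_infDist_pt _

theorem continuous_bdryDist : Continuous (bdryDist Ω) := lipschitzWith_bdryDist.continuous

theorem notMem_of_mem_frontier (hΩ : IsOpen Ω) {p : Euc N} (hp : p ∈ frontier Ω) : p ∉ Ω := by
  rw [hΩ.frontier_eq] at hp
  exact hp.2

theorem isCompact_frontier_of_isBounded (hb : Bornology.IsBounded Ω) : IsCompact (frontier Ω) :=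
  Metric.isCompact_of_isClosed_isBounded isClosed_frontier
    (hb.closure.subset frontier_subset_closure)

theorem frontier_nonempty (hN : 0 < N) (hb : Bornology.IsBounded Ω) (hne : Ω.Nonempty) :
    (frontier Ω).Nonempty := by
  have : Nonempty (Fin N) := ⟨⟨0, hN⟩⟩
  refine nonempty_frontier_iff.2 ⟨hne, fun h => ?_⟩
  rw [h] at hb
  exact NormedSpace.unbounded_univ ℝ (Euc N) hb

theorem bdryDist_pos (hΩ : IsOpen Ω) (hne : (frontier Ω).Nonempty) {x : Euc N} (hx : x ∈ Ω) :
    0 < bdryDist Ω x :=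
  (isClosed_frontier.notMem_iff_infDist_pos hne).1 fun h => notMem_of_mem_frontier hΩ h hx

theorem exists_nearest (hb : Bornology.IsBounded Ω) (hne : (frontier Ω).Nonempty) (x : Euc N) :
    ∃ p ∈ frontier Ω, bdryDist Ω x = ‖x - p‖ := by
  obtain ⟨p, hp, h⟩ := (isCompact_frontier_of_isBounded hb).exists_infDist_eq_dist hne x
  exact ⟨p, hp, by rw [bdryDist, h, dist_eq_norm]⟩

/-- The distance is 1-Lipschitz and decreases at unit rate along the ray towards a nearest boundary
point. -/
theorem norm_gradient_bdryDist (hΩ : IsOpen Ω) (hb : Bornology.IsBounded Ω)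
    (hne : (frontier Ω).Nonempty) {x : Euc N} (hx : x ∈ Ω)
    (hd : DifferentiableAt ℝ (bdryDist Ω) x) : ‖∇ (bdryDist Ω) x‖ = 1 := by
  rw [norm_gradient_eq_norm_fderiv]
  refine le_antisymm ?_ ?_
  · simpa using norm_fderiv_le_of_lipschitz ℝ (x₀ := x) (lipschitzWith_bdryDist (Ω := Ω))
  obtain ⟨p, hp, hxp⟩ := exists_nearest hb hne x
  have hpos := bdryDist_pos hΩ hne hx
  have hn : 0 < ‖x - p‖ := hxp ▸ hpos
  set e : Euc N := (1 / ‖x - p‖) • (p - x) with he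
  have hen : ‖e‖ = 1 := by
    rw [he, norm_smul, norm_sub_rev p x, Real.norm_of_nonneg (by positivity)]
    field_simp
  have h1 : HasLineDerivAt ℝ (bdryDist Ω) (fderiv ℝ (bdryDist Ω) x e) x e :=
    hd.hasFDerivAt.hasLineDerivAt e
  have h2 := h1.tendsto_slope_zero_right
  have h3 : fderiv ℝ (bdryDist Ω) x e ≤ -1 := by
    refine le_of_tendsto h2 ?_
    filter_upwards [Ioc_mem_nhdsGT hn] with t ht
    have h4 : bdryDist Ω (x + t • e) ≤ ‖x - p‖ - t := by
      refine (Metric.infDist_le_dist_of_mem hp).trans ?_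
      rw [dist_eq_norm]
      have h5 : x + t • e - p = (1 - t / ‖x - p‖) • (x - p) := by
        rw [he]; module
      rw [h5, norm_smul, Real.norm_of_nonneg (sub_nonneg.2 ((div_le_one hn).2 ht.2)), sub_mul,
        one_mul, div_mul_cancel₀ _ hn.ne']
    rw [smul_eq_mul, inv_mul_le_iff₀ ht.1]
    simp only [hxp]
    linarith
  have h6 := (fderiv ℝ (bdryDist Ω) x).le_opNorm e
  rw [hen, mul_one, Real.norm_eq_abs] at h6
  linarith [neg_le_abs (fderiv ℝ (bdryDist Ω) x e)]

theorem eq_zero_of_mem_frontier_of_sublevel (hΩ : IsOpen Ω) {U : Set (Euc N)} {ρ : Euc N → ℝ}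
    {p : Euc N} (hU : IsOpen U) (hpU : p ∈ U) (hp : p ∈ frontier Ω) (hc : ContinuousAt ρ p)
    (hsub : Ω ∩ U = {y ∈ U | ρ y < 0}) : ρ p = 0 := by
  refine le_antisymm ?_ ?_
  · by_contra! h
    have h1 : ∀ᶠ y in 𝓝 p, 0 < ρ y ∧ y ∈ U := (hc.eventually (lt_mem_nhds h)).and (hU.mem_nhds hpU)
    obtain ⟨y, hy, hyΩ⟩ := mem_closure_iff_nhds.1 hp.1 _ h1
    have h2 : y ∈ {y ∈ U | ρ y < 0} := hsub ▸ ⟨hyΩ, hy.2⟩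
    exact absurd h2.2 hy.1.not_gt
  · by_contra! h
    have h2 : p ∈ Ω ∩ U := hsub ▸ ⟨hpU, h⟩
    exact notMem_of_mem_frontier hΩ hp h2.1

/-- At a boundary point nearest to `x ∈ Ω`, the gradient of a defining function is a nonpositive
multiple of the direction towards `x`. -/
theorem gradient_eq_of_nearest (hΩ : IsOpen Ω) {U : Set (Euc N)} {ρ : Euc N → ℝ}
    {p x : Euc N} (hU : IsOpen U) (hpU : p ∈ U) (hp : p ∈ frontier Ω)
    (hd : DifferentiableAt ℝ ρ p) (hsub : Ω ∩ U = {y ∈ U | ρ y < 0}) (hx : x ∈ Ω)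
    (hxp : bdryDist Ω x = ‖x - p‖) {e : Euc N} (he : ‖e‖ = 1) (hxe : x - p = ‖x - p‖ • e)
    (hpos : 0 < ‖x - p‖) : ∇ ρ p = -(‖∇ ρ p‖ • e) := by
  have hρ0 := eq_zero_of_mem_frontier_of_sublevel hΩ hU hpU hp hd.continuousAt hsub
  have hinner : ∀ v, fderiv ℝ ρ p v = inner ℝ (∇ ρ p) v := fun v =>
    (InnerProductSpace.toDual_symm_apply (𝕜 := ℝ) (x := v) (y := fderiv ℝ ρ p)).symm
  -- Such a direction points from `p` into the ball of radius `d(x)` about `x`, which lies in `Ω`;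
  -- there `ρ < 0 = ρ p`.
  have h1 : ∀ v, 0 < inner ℝ v e → inner ℝ (∇ ρ p) v ≤ 0 := fun v hv => by
    rw [← hinner]
    have h2 := (hd.hasFDerivAt.hasLineDerivAt v).tendsto_slope_zero_right
    refine le_of_tendsto h2 ?_
    have h3 : ∀ᶠ t in 𝓝[>] (0 : ℝ), p + t • v ∈ U := by
      have : ContinuousAt (fun t : ℝ => p + t • v) 0 := by fun_prop
      exact nhdsWithin_le_nhds (this.preimage_mem_nhds (hU.mem_nhds (by simpa using hpU)))
    have hv0 : 0 < ‖v‖ := norm_pos_iff.2 fun h => by simp [h] at hv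
    have h4 : 0 < 2 * ‖x - p‖ * inner ℝ v e / ‖v‖ ^ 2 := by positivity
    filter_upwards [h3, Ioo_mem_nhdsGT h4] with t ht ht'
    have h5 : ‖x - (p + t • v)‖ < bdryDist Ω x := by
      rw [hxp]
      refine lt_of_pow_lt_pow_left₀ 2 (norm_nonneg _) ?_
      have h6 : inner ℝ (x - p) v = ‖x - p‖ * inner ℝ v e := by
        nth_rewrite 1 [hxe]
        rw [inner_smul_left, real_inner_comm]; simp
      have h7 := (lt_div_iff₀ (by positivity)).1 ht'.2
      rw [← sub_sub, norm_sub_sq_real, inner_smul_right, h6, norm_smul, mul_pow,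
        Real.norm_eq_abs, sq_abs]
      nlinarith [ht'.1]
    have h8 : p + t • v ∈ {y ∈ U | ρ y < 0} :=
      hsub ▸ ⟨mem_of_norm_sub_lt_bdryDist hΩ hx h5, ht⟩
    rw [hρ0, sub_zero, smul_eq_mul]
    exact mul_nonpos_of_nonneg_of_nonpos (inv_nonneg.2 ht'.1.le) h8.2.le
  have h2 : ∀ v, 0 ≤ inner ℝ v e → inner ℝ (∇ ρ p) v ≤ 0 := fun v hv => by
    have hT : Tendsto (fun t : ℝ => inner ℝ (∇ ρ p) (v + t • e)) (𝓝[>] 0)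
        (𝓝 (inner ℝ (∇ ρ p) (v + (0 : ℝ) • e))) :=
      (Continuous.tendsto (by fun_prop) 0).mono_left nhdsWithin_le_nhds
    rw [zero_smul, add_zero] at hT
    refine le_of_tendsto hT ?_
    filter_upwards [self_mem_nhdsWithin] with t ht
    refine h1 _ ?_
    rw [inner_add_left, inner_smul_left, real_inner_self_eq_norm_sq, he]
    have : (0 : ℝ) < t := ht
    simp; linarith
  set g := ∇ ρ p with hg
  have hee : inner ℝ e e = (1 : ℝ) := by rw [real_inner_self_eq_norm_sq, he, one_pow]
  have h3 : inner ℝ g e ≤ (0 : ℝ) := h2 e (by rw [hee]; exact zero_le_one)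
  -- Testing with the component of the gradient orthogonal to `e` forces that component to vanish.
  have h4 := h2 (g - (inner ℝ g e : ℝ) • e) (by
    rw [inner_sub_left, inner_smul_left, hee]; simp)
  have h5 : ‖g - (inner ℝ g e : ℝ) • e‖ ^ 2 ≤ 0 := by
    rw [inner_sub_right, inner_smul_right, real_inner_self_eq_norm_sq] at h4
    rw [norm_sub_sq_real, inner_smul_right, norm_smul, he, mul_one, Real.norm_eq_abs, sq_abs]
    nlinarith
  have h6 : g = (inner ℝ g e : ℝ) • e :=
    sub_eq_zero.1 (norm_eq_zero.1 (pow_eq_zero_iff two_ne_zero |>.1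
      (le_antisymm h5 (sq_nonneg _))))
  have h7 : ‖g‖ = -inner ℝ g e := by
    nth_rewrite 1 [h6]
    rw [norm_smul, he, mul_one, Real.norm_eq_abs, abs_of_nonpos h3]
  rw [h7, neg_smul, neg_neg]
  exact h6

/-- Uniform exterior ball condition: the ball of radius `r` touching `∂Ω` from outside at a point
nearest to some `x ∈ Ω` does not meet `Ω`. -/
theorem IsBoundedC2Domain.exists_exterior_radius (hΩ : IsBoundedC2Domain Ω) :
    ∃ r > 0, ∀ p ∈ frontier Ω, ∀ x ∈ Ω, ∀ e : Euc N, bdryDist Ω x = ‖x - p‖ → ‖e‖ = 1 →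
      x - p = ‖x - p‖ • e → 0 < ‖x - p‖ → ∀ y ∈ Ω,
        0 ≤ ‖y - p‖ ^ 2 + 2 * r * inner ℝ (y - p) e := by
  refine (isCompact_frontier_of_isBounded hΩ.isBounded).induction_on
    (p := fun S => ∃ r > 0, ∀ p ∈ S, ∀ x ∈ Ω, ∀ e : Euc N, bdryDist Ω x = ‖x - p‖ → ‖e‖ = 1 →
      x - p = ‖x - p‖ • e → 0 < ‖x - p‖ → ∀ y ∈ Ω,
        0 ≤ ‖y - p‖ ^ 2 + 2 * r * inner ℝ (y - p) e) ⟨1, one_pos, by simp⟩ ?_ ?_ ?_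
  · rintro s t hst ⟨r, hr, H⟩
    exact ⟨r, hr, fun p hp => H p (hst hp)⟩
  · have mono : ∀ {a b m r : ℝ}, 0 < m → m ≤ r → 0 ≤ a ^ 2 + 2 * r * b →
        0 ≤ a ^ 2 + 2 * m * b := fun {a b m r} hm hmr h => by
      rcases le_total 0 b with hb | hb
      · positivity
      · nlinarith
    rintro s t ⟨r, hr, H⟩ ⟨r', hr', H'⟩
    refine ⟨min r r', lt_min hr hr', fun p hp x hx e h1 h2 h3 h4 y hy => ?_⟩
    rcases hp with hp | hp
    · exact mono (lt_min hr hr') (min_le_left _ _) (H p hp x hx e h1 h2 h3 h4 y hy)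
    · exact mono (lt_min hr hr') (min_le_right _ _) (H' p hp x hx e h1 h2 h3 h4 y hy)
  · intro p₀ hp₀
    obtain ⟨U, ρ, hU, hpU, hρ, hne, hsub⟩ := hΩ.boundary p₀ hp₀
    have hat : ∀ p ∈ U, ContDiffAt ℝ 2 ρ p := fun p hp => hρ.contDiffAt (hU.mem_nhds hp)
    obtain ⟨L, hL, s₁, hs₁, hT⟩ := (hat p₀ hpU).exists_taylor_bound
    have hcont : ContinuousAt (fun p => ‖fderiv ℝ ρ p‖) p₀ :=
      ((hat p₀ hpU).fderiv_right (m := 1) (by norm_num)).continuousAt.norm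
    set m := ‖fderiv ℝ ρ p₀‖ / 2 with hm
    have hn0 : 0 < ‖fderiv ℝ ρ p₀‖ := norm_pos_iff.2 hne
    have hm0 : 0 < m := by positivity
    obtain ⟨s₂, hs₂, hball⟩ := Metric.mem_nhds_iff.1 (Filter.inter_mem (hU.mem_nhds hpU)
      (hcont.eventually (lt_mem_nhds (show m < ‖fderiv ℝ ρ p₀‖ by linarith))))
    set s := min s₁ s₂ / 2 with hs
    have hs0 : 0 < s := by positivity
    have hss₁ : 2 * s ≤ s₁ := by rw [hs]; linarith [min_le_left s₁ s₂]
    have hss₂ : 2 * s ≤ s₂ := by rw [hs]; linarith [min_le_right s₁ s₂]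
    -- The bound `2r ≤ s` handles `‖y - p‖ ≥ s` by Cauchy–Schwarz. For closer `y`, `2rL ≤ m` lets
    -- the lower bound `m` on the gradient of `ρ` dominate the quadratic Taylor error.
    set r := min (s / 2) (m / (2 * (L + 1))) with hr
    have hr0 : 0 < r := by positivity
    have hrs : 2 * r ≤ s := by linarith [min_le_left (s / 2) (m / (2 * (L + 1)))]
    have hrL : 2 * r * L ≤ m := by
      have h1 : r ≤ m / (2 * (L + 1)) := min_le_right _ _
      rw [le_div_iff₀ (by positivity)] at h1
      nlinarith
    refine ⟨Metric.ball p₀ s ∩ frontier Ω, inter_mem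
      (mem_nhdsWithin_of_mem_nhds (Metric.ball_mem_nhds _ hs0)) self_mem_nhdsWithin, r, hr0, ?_⟩
    rintro p ⟨hps, hp⟩ x hx e hxp he hxe hpos y hy
    rw [Metric.mem_ball] at hps
    have hcs : |inner ℝ (y - p) e| ≤ ‖y - p‖ := by
      simpa [he] using abs_real_inner_le_norm (y - p) e
    rcases le_or_gt s ‖y - p‖ with hys | hys
    · nlinarith [neg_abs_le (inner ℝ (y - p) e : ℝ), norm_nonneg (y - p)]
    · have hyb : dist y p₀ < 2 * s := by
        have := dist_triangle y p p₀
        rw [dist_eq_norm y p] at this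
        linarith
      have hpU' := hball (show p ∈ Metric.ball p₀ s₂ by rw [Metric.mem_ball]; linarith)
      have hyU := hball (show y ∈ Metric.ball p₀ s₂ by rw [Metric.mem_ball]; linarith)
      have h1 := hT p (by rw [Metric.mem_ball]; linarith) y (by rw [Metric.mem_ball]; linarith)
      have hdp : DifferentiableAt ℝ ρ p := (hat p hpU'.1).differentiableAt two_ne_zero
      have hg := gradient_eq_of_nearest hΩ.isOpen hU hpU'.1 hp hdp hsub hx hxp he hxe hpos
      have hρ0 := eq_zero_of_mem_frontier_of_sublevel hΩ.isOpen hU hpU'.1 hp hdp.continuousAt hsub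
      have hρy : y ∈ {y ∈ U | ρ y < 0} := hsub ▸ ⟨hy, hyU.1⟩
      have hin : fderiv ℝ ρ p (y - p) = -(‖∇ ρ p‖ * inner ℝ (y - p) e) := by
        rw [← InnerProductSpace.toDual_symm_apply (𝕜 := ℝ) (x := y - p) (y := fderiv ℝ ρ p)]
        change inner ℝ (∇ ρ p) (y - p) = _
        rw [hg, inner_neg_left, inner_smul_left, norm_neg, norm_smul, he, real_inner_comm]
        simp
      have hmg : m < ‖∇ ρ p‖ := by rw [norm_gradient_eq_norm_fderiv]; exact hpU'.2
      rw [hρ0, hin] at h1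
      have h2 := (abs_le.1 h1).1
      have h3 : ρ y < 0 := hρy.2
      rcases le_total 0 (inner ℝ (y - p) e : ℝ) with hb | hb
      · positivity
      · have h4 : -(L * ‖y - p‖ ^ 2) ≤ m * inner ℝ (y - p) e := by nlinarith
        have h5 : -(m * ‖y - p‖ ^ 2) ≤ m * (2 * r * inner ℝ (y - p) e) := by
          have h6 := mul_le_mul_of_nonneg_left h4 (show 0 ≤ 2 * r by positivity)
          have h7 := mul_le_mul_of_nonneg_right hrL (sq_nonneg ‖y - p‖)
          linarith
        have h8 : 0 ≤ m * (‖y - p‖ ^ 2 + 2 * r * inner ℝ (y - p) e) := by linarith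
        exact nonneg_of_mul_nonneg_right h8 hm0

end BoundaryDistance

/-! ### The three supersolutions -/

section Supersolutions

variable {N : ℕ} {Ω : Set (Euc N)}

/-- The Hardy potential `(N-2)²/(4|x|²)`. -/
noncomputable def hardyPotential (N : ℕ) (x : Euc N) : ℝ := ((N : ℝ) - 2) ^ 2 / (4 * ‖x‖ ^ 2)

theorem contDiffAt_hardyWeight {x : Euc N} (hx : x ≠ 0) : ContDiffAt ℝ 2 (hardyWeight N) x :=
  (contDiffAt_id.norm ℝ hx).rpow_const_of_ne (norm_ne_zero_iff.2 hx)

theorem hardyWeight_nonneg (x : Euc N) : 0 ≤ hardyWeight N x :=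
  Real.rpow_nonneg (norm_nonneg _) _

/-- For `g = A - |x|²` the Laplacian `-2N` and the cross term `2(N-2)` add up to `-4`, and `4 ≥
(4/A) g`. -/
theorem isSupersolution_paraboloid {O : Set (Euc N)} {A : ℝ} (hO : ∀ x ∈ O, x ≠ 0 ∧ ‖x‖ ^ 2 < A) :
    IsSupersolution O (fun x => hardyWeight N x * (A - ‖x‖ ^ 2))
      (fun x => hardyPotential N x + 4 / A) := by
  have hsm : ∀ x ∈ O, ContDiffAt ℝ 2 (fun x : Euc N => hardyWeight N x * (A - ‖x‖ ^ 2)) x :=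
    fun x hx => (contDiffAt_hardyWeight (hO x hx).1).mul
      (contDiffAt_const.sub (contDiff_norm_sq ℝ).contDiffAt)
  refine ⟨fun x hx => (hsm x hx).continuousAt.continuousWithinAt, fun x hx => ?_,
    fun K hKO hK => exists_bound_secondDiff hsm hK hKO, Eventually.of_forall fun x hx ε hε => ?_⟩
  · exact mul_pos (hardyWeight_pos (hO x hx).1) (sub_pos.2 (hO x hx).2)
  · obtain ⟨hx0, hxA⟩ := hO x hx
    have hn : 0 < ‖x‖ := norm_pos_iff.2 hx0
    have hA : 0 < A := lt_of_le_of_lt (sq_nonneg _) hxA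
    refine eventually_secondDiff_le_of_tendsto (tendsto_secondDiff_hardyWeight_mul hx0
      (g := fun y => A - ‖y‖ ^ 2)
      (fun i => (HasJet.const A).sub (hasJet_norm_sq x i))) ?_ hε
    have h1 : ∑ i, x i * (0 - 2 * x i) = -2 * ‖x‖ ^ 2 := by
      rw [← sum_sq_eq_norm_sq, Finset.mul_sum]
      exact Finset.sum_congr rfl fun i _ => by ring
    have h2 : ∑ i : Fin N, ((0 : ℝ) - 2) = -2 * N := by simp; ring
    rw [h1, h2]
    have h3 : -((N - 2 : ℝ) ^ 2 / (4 * ‖x‖ ^ 2)) * (A - ‖x‖ ^ 2) -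
        (N - 2) * (-2 * ‖x‖ ^ 2) / ‖x‖ ^ 2 + -2 * N =
        -((N - 2 : ℝ) ^ 2 / (4 * ‖x‖ ^ 2)) * (A - ‖x‖ ^ 2) - 4 := by
      field_simp; ring
    rw [h3, hardyPotential]
    have h4 : 4 / A * (A - ‖x‖ ^ 2) ≤ 4 := by
      rw [div_mul_eq_mul_div, div_le_iff₀ hA]; nlinarith
    have h5 := mul_le_mul_of_nonneg_left h4 (hardyWeight_nonneg x)
    linarith

/-- The sphere of radius `r` about `z` touches `∂Ω` from outside along the ray through `x`, so that
`|y - z| - r` bounds the boundary distance from above with equality at `x`. -/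
structure TouchesAt (Ω : Set (Euc N)) (r : ℝ) (x z : Euc N) : Prop where
  eq : ‖x - z‖ = bdryDist Ω x + r
  le : ∀ y ∈ Ω, bdryDist Ω y ≤ ‖y - z‖ - r

/-- Radius zero, centred at a nearest boundary point, requires no boundary regularity. -/
theorem exists_touchesAt_zero (hΩ : IsOpen Ω) (hb : Bornology.IsBounded Ω)
    (hne : (frontier Ω).Nonempty) (x : Euc N) : ∃ z ∈ frontier Ω, TouchesAt Ω 0 x z := by
  obtain ⟨p, hp, hxp⟩ := exists_nearest hb hne x
  refine ⟨p, hp, by rw [hxp, add_zero], fun y hy => ?_⟩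
  rw [sub_zero]
  exact bdryDist_le_norm_sub hΩ hy (notMem_of_mem_frontier hΩ hp)

theorem IsBoundedC2Domain.exists_touchesAt (hΩ : IsBoundedC2Domain Ω)
    (hne : (frontier Ω).Nonempty) : ∃ r > 0, ∀ x ∈ Ω,
      ∃ z ∈ Metric.cthickening r (frontier Ω), TouchesAt Ω r x z := by
  obtain ⟨r, hr, H⟩ := hΩ.exists_exterior_radius
  refine ⟨r, hr, fun x hx => ?_⟩
  obtain ⟨p, hp, hxp⟩ := exists_nearest hΩ.isBounded hne x
  have hpos : 0 < ‖x - p‖ := hxp ▸ bdryDist_pos hΩ.isOpen hne hx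
  set e : Euc N := (1 / ‖x - p‖) • (x - p) with he
  have hxe : x - p = ‖x - p‖ • e := by
    rw [he, smul_smul, mul_one_div_cancel hpos.ne', one_smul]
  have hen : ‖e‖ = 1 := by
    rw [he, norm_smul, Real.norm_of_nonneg (by positivity)]
    field_simp
  have hout : ∀ y ∈ Ω, r ≤ ‖y - (p - r • e)‖ := fun y hy => by
    refine le_of_sq_le_sq ?_ (norm_nonneg _)
    have h1 := H p hp x hx e hxp hen hxe hpos y hy
    have h2 : y - (p - r • e) = (y - p) + r • e := by abel
    rw [h2, norm_add_sq_real, inner_smul_right, norm_smul, hen, mul_one, Real.norm_eq_abs, sq_abs]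
    linarith
  refine ⟨p - r • e, ?_, ?_, fun y hy => ?_⟩
  · refine Metric.mem_cthickening_of_dist_le _ p _ _ hp ?_
    rw [dist_eq_norm, sub_sub_cancel_left, norm_neg, norm_smul, hen, mul_one,
      Real.norm_of_nonneg hr.le]
  · have h2 : x - (p - r • e) = (‖x - p‖ + r) • e := by
      rw [add_smul, ← hxe]; abel
    rw [h2, norm_smul, hen, mul_one, hxp, Real.norm_of_nonneg (by positivity)]
  · refine bdryDist_le_of_disjoint_ball hΩ.isOpen hy (fun hz => ?_) hout
    have := hout _ hz
    rw [sub_self, norm_zero] at this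
    linarith

/-- The weighted comparison functions touching `|x|^{-(N-2)/2} d^{1/2}` from above. -/
noncomputable def comparison (N : ℕ) (r : ℝ) (z y : Euc N) : ℝ :=
  hardyWeight N y * √(‖y - z‖ - r)

/-- The contact relation `‖x - z‖ = d(x) + r` cuts out a compact set of pairs on which the
comparison function is jointly `C²`, so the bound is uniform in the centre `z`, which varies with
`x`. -/
theorem exists_bound_secondDiff_comparison {r : ℝ} (hr : 0 ≤ r) {K Z : Set (Euc N)}
    (hK : IsCompact K) (hZ : IsCompact Z) (hK0 : ∀ x ∈ K, x ≠ 0)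
    (hKd : ∀ x ∈ K, 0 < bdryDist Ω x) :
    ∃ M : ℝ, ∃ h₀ > 0, ∀ x ∈ K, ∀ z ∈ Z, TouchesAt Ω r x z → ∀ h, 0 < h → h < h₀ →
      secondDiff (comparison N r z) x h ≤ M * h ^ 2 := by
  have hc : IsCompact ((K ×ˢ Z) ∩ {p | ‖p.1 - p.2‖ = bdryDist Ω p.1 + r}) := by
    refine (hK.prod hZ).inter_right (isClosed_eq (by fun_prop) ?_)
    exact (continuous_bdryDist.comp continuous_fst).add continuous_const
  have hsm : ∀ p ∈ {p : Euc N × Euc N | p.1 ≠ 0 ∧ r < ‖p.1 - p.2‖},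
      ContDiffAt ℝ 2 (fun p : Euc N × Euc N => comparison N r p.2 p.1) p := fun p hp => by
    have h1 : ‖p.1 - p.2‖ - r ≠ 0 := (sub_pos.2 hp.2).ne'
    have h2 : p.1 - p.2 ≠ 0 := norm_pos_iff.1 (hr.trans_lt hp.2)
    have h3 : ContDiffAt ℝ 2 (fun p : Euc N × Euc N => hardyWeight N p.1) p :=
      ContDiffAt.comp p (contDiffAt_hardyWeight hp.1) contDiffAt_fst
    exact h3.mul
      ((((contDiffAt_fst.sub contDiffAt_snd).norm ℝ h2).sub contDiffAt_const).sqrt h1)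
  obtain ⟨M, h₀, h0, H⟩ := exists_bound_secondDiff_family hsm hc fun p hp =>
    ⟨hK0 _ hp.1.1, by linarith [hp.2.ge, hKd _ hp.1.1]⟩
  exact ⟨M, h₀, h0, fun x hx z hz ht h => H x z ⟨⟨hx, hz⟩, ht.eq⟩ h⟩

theorem hasJet_norm_sub {x z : Euc N} (hxz : x ≠ z) (i : Fin N) :
    HasJet (fun t => ‖x + t • basisVec i - z‖) ‖x - z‖ ((x - z) i / ‖x - z‖)
      (1 / ‖x - z‖ - (x - z) i ^ 2 / ‖x - z‖ ^ 3) := by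
  have hn : 0 < ‖x - z‖ := norm_pos_iff.2 (sub_ne_zero.2 hxz)
  have h1 := hasJet_norm_rpow (sub_ne_zero.2 hxz) 1 i
  simp only [Real.rpow_one] at h1
  have e : ∀ t : ℝ, x + t • basisVec i - z = x - z + t • basisVec i := fun t => by abel
  simp_rw [e]
  convert h1 using 1
  · field_simp
  · field_simp; ring

theorem tendsto_secondDiff_comparison {x z : Euc N} {r : ℝ} (hx : x ≠ 0) (hr : 0 ≤ r)
    (hs : 0 < ‖x - z‖ - r) :
    Tendsto (fun h => secondDiff (comparison N r z) x h / h ^ 2) (𝓝[>] 0)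
      (𝓝 (hardyWeight N x * √(‖x - z‖ - r) * (-hardyPotential N x
        - ((N : ℝ) - 2) * inner ℝ x (x - z) / (2 * ‖x - z‖ * (‖x - z‖ - r) * ‖x‖ ^ 2)
        + ((N : ℝ) - 1) / (2 * ‖x - z‖ * (‖x - z‖ - r)) - 1 / (4 * (‖x - z‖ - r) ^ 2)))) := by
  have hn : 0 < ‖x - z‖ := by linarith
  have hxz : x ≠ z := sub_ne_zero.1 (norm_pos_iff.1 hn)
  have h1 := tendsto_secondDiff_hardyWeight_mul hx (g := fun y => √(‖y - z‖ - r))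
    (fun i => ((hasJet_norm_sub hxz i).sub (HasJet.const r)).sqrt hs)
  have hinner : ∑ i, x i * ((x - z) i / ‖x - z‖ - 0) / (2 * √(‖x - z‖ - r)) =
      inner ℝ x (x - z) / (2 * ‖x - z‖ * √(‖x - z‖ - r)) := by
    rw [PiLp.inner_apply, Finset.sum_div]
    refine Finset.sum_congr rfl fun i _ => ?_
    have e : inner ℝ (x i) ((x - z) i) = x i * (x - z) i := by simp [mul_comm]
    rw [e, sub_zero]
    field_simp
  convert h1 using 2
  · rfl
  set n := ‖x - z‖ with hn'
  set s := n - r with hs'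
  have hsq : 0 < √s := Real.sqrt_pos.2 hs
  have hss : √s ^ 2 = s := Real.sq_sqrt hs.le
  have e1 : ∑ i, x i * (((x - z) i / n - 0) / (2 * √s)) =
      inner ℝ x (x - z) / (2 * n * √s) := by
    rw [← hinner]
    exact Finset.sum_congr rfl fun i _ => by ring
  have e2 : ∀ i, ((1 / n - (x - z) i ^ 2 / n ^ 3 - 0) / (2 * √s)
      - ((x - z) i / n - 0) ^ 2 / (4 * s * √s)) = 1 / n / (2 * √s) -
      (1 / n ^ 3 / (2 * √s) + 1 / n ^ 2 / (4 * s * √s)) * (x - z) i ^ 2 := fun i => by ring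
  simp_rw [e1, e2]
  rw [Finset.sum_sub_distrib, ← Finset.mul_sum, sum_sq_eq_norm_sq, ← hn']
  simp only [Finset.sum_const, Finset.card_univ, Fintype.card_fin, nsmul_eq_mul]
  rw [hardyPotential, mul_assoc]
  congr 1
  have hx' : 0 < ‖x‖ := norm_pos_iff.2 hx
  generalize √s = q at *
  rw [← hss]
  field_simp
  ring

/-- Where `d ≤ δ`, the function is touched from above by `comparison N r z`, whose Laplacian
supplies `-1/(4d²)` with errors of order `1/d`. Where `d ≥ δ`, it is touched by a multiple of the
Hardy ground state. Truncation keeps the cross term, singular at the origin, away from it; a minimum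
of supersolutions only has kinks of the favourable sign. -/
theorem isSupersolution_truncated (hN : 3 ≤ N) (hΩ : IsBoundedC2Domain Ω) (h0 : (0 : Euc N) ∈ Ω) :
    ∃ (w : Euc N → ℝ) (K : ℝ), 0 ≤ K ∧ IsSupersolution (Ω \ {0}) w
      (fun x => hardyPotential N x + 1 / (8 * bdryDist Ω x ^ 2) - K) := by
  have hne := frontier_nonempty (by omega) hΩ.isBounded hΩ.isConnected.nonempty
  have hdpos : ∀ x ∈ Ω, 0 < bdryDist Ω x := fun x hx => bdryDist_pos hΩ.isOpen hne hx
  obtain ⟨r, hr, hT⟩ := hΩ.exists_touchesAt hne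
  set δ := bdryDist Ω 0 / 2 with hδ
  have hδ0 : 0 < δ := by have := hdpos 0 h0; positivity
  have hN' : (3 : ℝ) ≤ N := by exact_mod_cast hN
  -- The first summand bounds the cross term using `‖x‖ ≥ δ`, the second the curvature term using
  -- `‖x - z‖ ≥ r`.
  set κ : ℝ := ((N : ℝ) - 2) / (2 * δ) + ((N : ℝ) - 1) / (2 * r) with hκ
  set w : Euc N → ℝ := fun x => hardyWeight N x * √(min (bdryDist Ω x) δ) with hw
  have hle1 : ∀ z, ∀ y ∈ Ω, bdryDist Ω y ≤ ‖y - z‖ - r → w y ≤ comparison N r z y :=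
    fun z y _ h => mul_le_mul_of_nonneg_left
      (Real.sqrt_le_sqrt ((min_le_left _ _).trans h)) (hardyWeight_nonneg y)
  have hle2 : ∀ y, w y ≤ hardyWeight N y * √δ := fun y => mul_le_mul_of_nonneg_left
      (Real.sqrt_le_sqrt (min_le_right _ _)) (hardyWeight_nonneg y)
  have heq1 : ∀ x z, bdryDist Ω x ≤ δ → TouchesAt Ω r x z → w x = comparison N r z x :=
    fun x z h ht => by simp only [hw, comparison, ht.eq, min_eq_left h, add_sub_cancel_right]
  have heq2 : ∀ x, δ ≤ bdryDist Ω x → w x = hardyWeight N x * √δ :=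
    fun x h => by simp only [hw, min_eq_right h]
  -- The summand `2κ²` pays for absorbing `κ/d` near the boundary; `1/(8δ²)` cancels `1/(8d²)` where
  -- `d ≥ δ`.
  refine ⟨w, 2 * κ ^ 2 + 1 / (8 * δ ^ 2), by positivity, ?_, ?_, ?_, ?_⟩
  · intro x hx
    have h1 : ContinuousAt (hardyWeight N) x := (contDiffAt_hardyWeight hx.2).continuousAt
    exact (h1.mul ((continuous_bdryDist.min continuous_const).sqrt.continuousAt)).continuousWithinAt
  · intro x hx
    exact mul_pos (hardyWeight_pos hx.2) (Real.sqrt_pos.2 (lt_min (hdpos x hx.1) hδ0))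
  · intro K hKO hK
    obtain ⟨M₁, h₁, h₁0, H₁⟩ := exists_bound_secondDiff_comparison (Ω := Ω) hr.le hK
      ((isCompact_frontier_of_isBounded hΩ.isBounded).cthickening (r := r))
      (fun x hx => (hKO hx).2) (fun x hx => hdpos x (hKO hx).1)
    obtain ⟨M₂, h₂, h₂0, H₂⟩ := exists_bound_secondDiff
      (w := fun y : Euc N => hardyWeight N y * √δ) (S := {0}ᶜ)
      (fun p hp => (contDiffAt_hardyWeight hp).mul contDiffAt_const) hK (fun x hx => (hKO hx).2)
    obtain ⟨η, hη, hsub⟩ := hK.exists_cthickening_subset_open hΩ.isOpen fun x hx => (hKO hx).1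
    refine ⟨max M₁ M₂, min (min h₁ h₂) η, by positivity, fun x hx h hh0 hh => ?_⟩
    have hxη : Metric.cthickening η {x} ⊆ Ω :=
      (Metric.cthickening_subset_of_subset _ (Set.singleton_subset_iff.2 hx)).trans hsub
    have hhη : h ≤ η := (hh.trans_le (min_le_right _ _)).le
    have hh1 : h < h₁ := hh.trans_le ((min_le_left _ _).trans (min_le_left _ _))
    have hh2 : h < h₂ := hh.trans_le ((min_le_left _ _).trans (min_le_right _ _))
    rcases le_total (bdryDist Ω x) δ with hd | hd
    · obtain ⟨z, hz, ht⟩ := hT x (hKO hx).1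
      refine (secondDiff_le_of_touching_on hxη hh0 hhη (heq1 x z hd ht)
        fun y hy => hle1 z y hy (ht.le y hy)).trans ?_
      refine (H₁ x hx z hz ht h hh0 hh1).trans ?_
      gcongr
      exact le_max_left _ _
    · refine (secondDiff_le_of_touching_on hxη hh0 hhη (heq2 x hd) fun y _ => hle2 y).trans ?_
      refine (H₂ x hx h hh0 hh2).trans ?_
      gcongr
      exact le_max_right _ _
  · refine Eventually.of_forall fun x hx ε hε => ?_
    have hx0 : x ≠ 0 := hx.2
    have hdx := hdpos x hx.1
    have hnx : 0 < ‖x‖ := norm_pos_iff.2 hx0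
    rcases le_total (bdryDist Ω x) δ with hd | hd
    · obtain ⟨z, -, ht⟩ := hT x hx.1
      have hs : ‖x - z‖ - r = bdryDist Ω x := by rw [ht.eq, add_sub_cancel_right]
      have h1 := tendsto_secondDiff_comparison (N := N) hx0 hr.le (z := z) (by rwa [hs])
      have hev := eventually_secondDiff_le_of_touching hΩ.isOpen hx.1 (heq1 x z hd ht)
        (fun y hy => hle1 z y hy (ht.le y hy))
      refine (hev.and (eventually_secondDiff_le_of_tendsto h1 ?_ hε)).mono
        fun h hh => hh.1.trans hh.2
      rw [heq1 x z hd ht, comparison, hs, mul_comm (-(_ - _))]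
      refine mul_le_mul_of_nonneg_left ?_ (mul_nonneg (hardyWeight_nonneg x) (Real.sqrt_nonneg _))
      have hn : 0 < ‖x - z‖ := by rw [ht.eq]; positivity
      have hrn : r ≤ ‖x - z‖ := by rw [ht.eq]; linarith
      -- Since `d(0) = 2δ`, `d(x) ≤ δ` and `d` is 1-Lipschitz.
      have hδx : δ ≤ ‖x‖ := by
        have h2 := (lipschitzWith_bdryDist (Ω := Ω)).dist_le_mul 0 x
        rw [NNReal.coe_one, one_mul, dist_zero_left, Real.dist_eq] at h2
        have h3 := (abs_le.1 h2).2
        linarith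
      set s := bdryDist Ω x
      have b1 : -(((N : ℝ) - 2) * inner ℝ x (x - z) / (2 * ‖x - z‖ * s * ‖x‖ ^ 2)) ≤
          ((N : ℝ) - 2) / (2 * δ) / s := by
        have h2 : -(inner ℝ x (x - z) : ℝ) ≤ ‖x‖ * ‖x - z‖ :=
          (neg_le_abs _).trans (abs_real_inner_le_norm _ _)
        calc -(((N : ℝ) - 2) * inner ℝ x (x - z) / (2 * ‖x - z‖ * s * ‖x‖ ^ 2))
            = ((N : ℝ) - 2) * (-inner ℝ x (x - z)) / (2 * ‖x - z‖ * s * ‖x‖ ^ 2) := by ring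
          _ ≤ ((N : ℝ) - 2) * (‖x‖ * ‖x - z‖) / (2 * ‖x - z‖ * s * ‖x‖ ^ 2) := by
              gcongr
              linarith
          _ = ((N : ℝ) - 2) / (2 * ‖x‖) / s := by field_simp
          _ ≤ _ := by
              have : (0 : ℝ) ≤ N - 2 := by linarith
              gcongr
      have b2 : ((N : ℝ) - 1) / (2 * ‖x - z‖ * s) ≤ ((N : ℝ) - 1) / (2 * r) / s := by
        rw [div_div]
        have : (0 : ℝ) ≤ N - 1 := by linarith
        gcongr
      have b3 : κ / s ≤ 2 * κ ^ 2 + 1 / (8 * s ^ 2) := by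
        have e : 2 * κ ^ 2 + 1 / (8 * s ^ 2) - κ / s = 2 * (κ - 1 / (4 * s)) ^ 2 := by
          field_simp; ring
        have := sq_nonneg (κ - 1 / (4 * s))
        linarith
      have b4 : ((N : ℝ) - 2) / (2 * δ) / s + ((N : ℝ) - 1) / (2 * r) / s = κ / s := by
        rw [hκ, add_div]
      have b5 : 1 / (4 * s ^ 2) = 1 / (8 * s ^ 2) + 1 / (8 * s ^ 2) := by field_simp; norm_num
      have b6 : 0 ≤ 1 / (8 * δ ^ 2) := by positivity
      linarith
    · have h1 := tendsto_secondDiff_hardyWeight_mul hx0 (g := fun _ => √δ)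
        fun i => HasJet.const (√δ)
      have hev := eventually_secondDiff_le_of_touching hΩ.isOpen hx.1 (heq2 x hd)
        (fun y _ => hle2 y)
      refine (hev.and (eventually_secondDiff_le_of_tendsto h1 ?_ hε)).mono
        fun h hh => hh.1.trans hh.2
      rw [heq2 x hd, ← hardyPotential]
      have b1 : 1 / (8 * bdryDist Ω x ^ 2) ≤ 1 / (8 * δ ^ 2) := by gcongr
      have b2 : 0 ≤ hardyWeight N x * √δ := mul_nonneg (hardyWeight_nonneg x) (Real.sqrt_nonneg _)
      simp only [mul_zero, Finset.sum_const_zero, zero_div, sub_zero, add_zero]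
      nlinarith [sq_nonneg κ]

/-- Differentiability of the weighted field at one point already makes `d` differentiable in a whole
neighbourhood. The second derivatives then come from the product rule for `∇d = |x|^{N-2} F`, with
`F` the weighted field. -/
theorem hasJet_bdryDist_of_differentiableAt (hΩ : IsOpen Ω)
    (hb : Bornology.IsBounded Ω) (hne : (frontier Ω).Nonempty) {x : Euc N} (hx : x ∈ Ω)
    (hx0 : x ≠ 0) (hd : DifferentiableAt ℝ (bdryDist Ω) x)
    (hF : DifferentiableAt ℝ (weightedGradDist Ω) x) (i : Fin N) :
    HasJet (fun t => bdryDist Ω (x + t • basisVec i)) (bdryDist Ω x) ((∇ (bdryDist Ω) x) i)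
      (((N : ℝ) - 2) / ‖x‖ ^ 2 * (x i * (∇ (bdryDist Ω) x) i) +
        ‖x‖ ^ ((N : ℝ) - 2) * (fderiv ℝ (weightedGradDist Ω) x (basisVec i)) i) := by
  have hnx : 0 < ‖x‖ := norm_pos_iff.2 hx0
  have hinv : ∀ y : Euc N, y ≠ 0 →
      ∇ (bdryDist Ω) y = ‖y‖ ^ ((N : ℝ) - 2) • weightedGradDist Ω y := fun y hy => by
    rw [weightedGradDist, smul_smul, ← Real.rpow_add (norm_pos_iff.2 hy)]
    simp
  have hne0 : weightedGradDist Ω x ≠ 0 := fun h => by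
    have h1 := norm_gradient_bdryDist hΩ hb hne hx hd
    rw [hinv x hx0, h] at h1
    simp at h1
  have hev : ∀ᶠ y in 𝓝 x, y ≠ 0 ∧ DifferentiableAt ℝ (bdryDist Ω) y := by
    filter_upwards [hF.continuousAt.eventually_ne hne0, isOpen_ne.mem_nhds hx0] with y h1 h2
    refine ⟨h2, ?_⟩
    by_contra h3
    apply h1
    -- Where `d` is not differentiable its gradient takes the default value zero, so the field would
    -- vanish; near `x` it cannot, being continuous and nonzero at `x`.
    rw [weightedGradDist, gradient, fderiv_zero_of_not_differentiableAt h3]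
    simp
  have hline : Tendsto (fun t : ℝ => x + t • basisVec i) (𝓝 0) (𝓝 x) := by
    have : Continuous fun t : ℝ => x + t • basisVec i := by fun_prop
    simpa using this.tendsto 0
  have hlineD : ∀ t : ℝ, HasDerivAt (fun t : ℝ => x + t • basisVec i) (basisVec i) t := fun t => by
    simpa using ((hasDerivAt_id t).smul_const (basisVec i)).const_add x
  have hev' := hline.eventually hev
  refine ⟨fun t => (∇ (bdryDist Ω) (x + t • basisVec i)) i, ?_, ?_, by simp, by simp⟩
  · filter_upwards [hev'] with t ht
    rw [gradient_apply]
    exact ht.2.hasFDerivAt.comp_hasDerivAt t (hlineD t)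
  · have h1 : HasDerivAt (fun t : ℝ => (weightedGradDist Ω (x + t • basisVec i)) i)
        ((fderiv ℝ (weightedGradDist Ω) x (basisVec i)) i) 0 := by
      have hF' : HasFDerivAt (weightedGradDist Ω) (fderiv ℝ (weightedGradDist Ω) x)
          (x + (0 : ℝ) • basisVec i) := by simpa using hF.hasFDerivAt
      exact (EuclideanSpace.proj i : Euc N →L[ℝ] ℝ).hasFDerivAt.comp_hasDerivAt (0 : ℝ)
        (hF'.comp_hasDerivAt (0 : ℝ) (hlineD 0))
    obtain ⟨ψ', p1, -, p3, p4⟩ := hasJet_norm_rpow hx0 ((N : ℝ) - 2) i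
    have h2 := p1.self_of_nhds.fun_mul h1
    refine (h2.congr_of_eventuallyEq ?_).congr_deriv ?_
    · filter_upwards [hev'] with t ht
      rw [hinv _ ht.1]
      simp
    · rw [p3]
      rw [hinv x hx0]
      simp only [zero_smul, add_zero, PiLp.smul_apply, smul_eq_mul]
      ring

/-- The cross term of the ground state cancels the `x·∇d` part of `Δd`, leaving `|x|^{N-2}
div(|x|^{2-N}∇d)/(2√d) ≤ 0` and, as `|∇d| = 1`, exactly `-√d/(4d²)`. Points of nondifferentiability
of `d` are discarded by Rademacher's theorem, while the local upper bound uses touching at radius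
zero. -/
theorem isSupersolution_of_divCondition (hΩ : IsOpen Ω)
    (hb : Bornology.IsBounded Ω) (hne : (frontier Ω).Nonempty) (hdiv : DivCondition Ω) :
    IsSupersolution (Ω \ {0}) (fun x => hardyWeight N x * √(bdryDist Ω x))
      (fun x => hardyPotential N x + 1 / (4 * bdryDist Ω x ^ 2)) := by
  have hdpos : ∀ x ∈ Ω, 0 < bdryDist Ω x := fun x hx => bdryDist_pos hΩ hne hx
  refine ⟨?_, ?_, ?_, ?_⟩
  · intro x hx
    have h1 : ContinuousAt (hardyWeight N) x := (contDiffAt_hardyWeight hx.2).continuousAt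
    exact (h1.mul continuous_bdryDist.sqrt.continuousAt).continuousWithinAt
  · intro x hx
    exact mul_pos (hardyWeight_pos hx.2) (Real.sqrt_pos.2 (hdpos x hx.1))
  · intro K hKO hK
    obtain ⟨M₁, h₁, h₁0, H₁⟩ := exists_bound_secondDiff_comparison (Ω := Ω) le_rfl hK
      (isCompact_frontier_of_isBounded hb)
      (fun x hx => (hKO hx).2) (fun x hx => hdpos x (hKO hx).1)
    obtain ⟨η, hη, hsub⟩ := hK.exists_cthickening_subset_open hΩ fun x hx => (hKO hx).1
    refine ⟨M₁, min h₁ η, by positivity, fun x hx h hh0 hh => ?_⟩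
    have hxη : Metric.cthickening η {x} ⊆ Ω :=
      (Metric.cthickening_subset_of_subset _ (Set.singleton_subset_iff.2 hx)).trans hsub
    obtain ⟨z, hz, ht⟩ := exists_touchesAt_zero hΩ hb hne x
    refine (secondDiff_le_of_touching_on hxη hh0 (hh.trans_le (min_le_right _ _)).le
      (W := comparison N 0 z) ?_ fun y hy => ?_).trans
      (H₁ x hx z hz ht h hh0 (hh.trans_le (min_le_left _ _)))
    · simp only [comparison, ht.eq, add_zero, sub_zero]
    · exact mul_le_mul_of_nonneg_left (Real.sqrt_le_sqrt (ht.le y hy)) (hardyWeight_nonneg y)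
  · have hrad : ∀ᵐ x : Euc N, DifferentiableAt ℝ (bdryDist Ω) x :=
      lipschitzWith_bdryDist.ae_differentiableAt
    filter_upwards [hrad, (ae_restrict_iff' hΩ.measurableSet).1 hdiv] with x hd hF hx ε hε
    have hx0 : x ≠ 0 := hx.2
    have hdx := hdpos x hx.1
    have hnx : 0 < ‖x‖ := norm_pos_iff.2 hx0
    obtain ⟨hFd, hFv⟩ := hF hx.1
    refine eventually_secondDiff_le_of_tendsto (tendsto_secondDiff_hardyWeight_mul hx0
      (fun i => (hasJet_bdryDist_of_differentiableAt hΩ hb hne hx.1 hx0 hd hFd i).sqrt hdx))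
      ?_ hε
    have hG : ∑ i, (∇ (bdryDist Ω) x) i ^ 2 = 1 := by
      rw [sum_sq_eq_norm_sq, norm_gradient_bdryDist hΩ hb hne hx.1 hd, one_pow]
    set G := ∇ (bdryDist Ω) x with hGdef
    set s := bdryDist Ω x with hs
    have hsq : 0 < √s := Real.sqrt_pos.2 hdx
    have hss : √s ^ 2 = s := Real.sq_sqrt hdx.le
    set P := ∑ i, x i * G i with hP
    have e1 : ∑ i, x i * (G i / (2 * √s)) = P / (2 * √s) := by
      rw [hP, Finset.sum_div]
      exact Finset.sum_congr rfl fun i _ => by ring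
    have e2 : ∑ i, ((((N : ℝ) - 2) / ‖x‖ ^ 2 * (x i * G i) +
        ‖x‖ ^ ((N : ℝ) - 2) * (fderiv ℝ (weightedGradDist Ω) x (basisVec i)) i) / (2 * √s) -
        G i ^ 2 / (4 * s * √s)) =
        (((N : ℝ) - 2) / ‖x‖ ^ 2 * P + ‖x‖ ^ ((N : ℝ) - 2) * vdiv (weightedGradDist Ω) x) /
          (2 * √s) - 1 / (4 * s * √s) := by
      rw [Finset.sum_sub_distrib, ← Finset.sum_div, ← Finset.sum_div, hG,
        Finset.sum_add_distrib, ← Finset.mul_sum, ← Finset.mul_sum, vdiv]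
    rw [e1, e2, ← hardyPotential, mul_left_comm]
    refine mul_le_mul_of_nonneg_left ?_ (hardyWeight_nonneg x)
    have e3 : 1 / (4 * s * √s) = √s * (1 / (4 * s ^ 2)) := by
      have : s ^ 2 = s * √s ^ 2 := by rw [hss]; ring
      rw [this]; field_simp
    have e4 : ‖x‖ ^ ((N : ℝ) - 2) * vdiv (weightedGradDist Ω) x / (2 * √s) ≤ 0 := by
      refine div_nonpos_of_nonpos_of_nonneg (mul_nonpos_of_nonneg_of_nonpos ?_ ?_) (by positivity)
      · positivity
      · linarith
    have e5 : ((N : ℝ) - 2) * (P / (2 * √s)) / ‖x‖ ^ 2 =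
        ((N : ℝ) - 2) / ‖x‖ ^ 2 * P / (2 * √s) := by ring
    rw [e3, e5, add_div]
    linarith

end Supersolutions

/-! ### Integrability and assembly of the inequalities -/

section Conclusion

variable {N : ℕ} {Ω : Set (Euc N)} {u : Euc N → ℝ}

theorem integrable_hardyPotential_mul_sq (hN : 3 ≤ N) (hu : Continuous u)
    (huc : HasCompactSupport u) : Integrable fun x => hardyPotential N x * u x ^ 2 := by
  have hloc : LocallyIntegrable (hardyPotential N) (volume : Measure (Euc N)) := by
    refine locallyIntegrable_of_norm_le_rpow (C := ((N : ℝ) - 2) ^ 2 / 4) (α := 2) ?_ ?_ ?_ ?_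
    · rw [finrank_euclideanSpace, Fintype.card_fin]; omega
    · rw [finrank_euclideanSpace, Fintype.card_fin]; exact_mod_cast hN
    · refine Eventually.of_forall fun x => ?_
      rw [hardyPotential, Real.norm_of_nonneg (by positivity), Real.rpow_neg (norm_nonneg _),
        Real.rpow_two]
      exact (by ring : ((N : ℝ) - 2) ^ 2 / (4 * ‖x‖ ^ 2) =
        ((N : ℝ) - 2) ^ 2 / 4 * (‖x‖ ^ 2)⁻¹).le
    · exact (measurable_const.div ((measurable_norm.pow_const 2).const_mul 4)).aestronglyMeasurable
  have h2 : HasCompactSupport fun x => u x ^ 2 :=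
    huc.comp_left (g := fun t : ℝ => t ^ 2) (by simp)
  simpa [mul_comm] using
    hloc.integrable_smul_left_of_hasCompactSupport (hu.pow 2) h2

theorem integrable_sq (hu : Continuous u) (huc : HasCompactSupport u) :
    Integrable fun x => u x ^ 2 := by
  refine Continuous.integrable_of_hasCompactSupport (by fun_prop) ?_
  exact huc.comp_left (g := fun t : ℝ => t ^ 2) (by simp)

theorem integrable_sq_div_bdryDist (hΩ : IsOpen Ω) (hne : (frontier Ω).Nonempty)
    (hu : Continuous u) (huc : HasCompactSupport u) (hK : tsupport u ⊆ Ω) :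
    Integrable fun x => u x ^ 2 / bdryDist Ω x ^ 2 := by
  have hc : Continuous fun x => u x ^ 2 / bdryDist Ω x ^ 2 :=
    continuous_sq_div hΩ (continuous_bdryDist.pow 2).continuousOn
      (fun x hx => pow_pos (bdryDist_pos hΩ hne hx) 2) hu hK
  exact hc.integrable_of_hasCompactSupport
    (huc.of_isClosed_subset (isClosed_tsupport _) tsupport_sq_div)

theorem gradient_eq_zero_of_notMem_tsupport {x : Euc N} (hx : x ∉ tsupport u) : ∇ u x = 0 := by
  have : fderiv ℝ u x = 0 := by
    by_contra h
    exact hx (support_fderiv_subset ℝ h)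
  rw [gradient, this, map_zero]

theorem setIntegral_eq_integral_of_tsupport {f : Euc N → ℝ} (hK : tsupport u ⊆ Ω)
    (hf : ∀ x, x ∉ tsupport u → f x = 0) : ∫ x in Ω, f x = ∫ x, f x :=
  setIntegral_eq_integral_of_forall_compl_eq_zero fun x hx => hf x fun h => hx (hK h)

theorem IsTestFunction.contDiff_one (hu : IsTestFunction Ω u) : ContDiff ℝ 1 u :=
  hu.smooth.of_le (by exact_mod_cast le_top)

/-- The improved Hardy inequality follows from the corresponding inequality for the potential on
the whole space. -/
theorem improvedHardy_of_forall (hN : 3 ≤ N) (hΩ : IsOpen Ω) (hne : (frontier Ω).Nonempty) {C : ℝ}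
    (H : ∀ u : Euc N → ℝ, IsTestFunction Ω u →
      (∫ x, hardyPotential N x * u x ^ 2) + C * (∫ x, u x ^ 2 / bdryDist Ω x ^ 2)
        ≤ ∫ x, ‖∇ u x‖ ^ 2) : ImprovedHardy Ω C := by
  intro u hu
  have hu1 := hu.contDiff_one
  have I1 := integrable_hardyPotential_mul_sq hN hu1.continuous hu.compactSupport
  have I2 := integrable_sq_div_bdryDist hΩ hne hu1.continuous hu.compactSupport hu.support_subset
  have I3 := integrable_norm_gradient_sq hu1 hu.compactSupport
  have I4 : Integrable fun x => ‖∇ u x‖ ^ 2 - ((N : ℝ) - 2) ^ 2 / (4 * ‖x‖ ^ 2) * u x ^ 2 :=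
    I3.sub I1
  refine ⟨I4.integrableOn, I2.integrableOn, ?_⟩
  rw [setIntegral_eq_integral_of_tsupport hu.support_subset, setIntegral_eq_integral_of_tsupport
    hu.support_subset]
  · have h1 : ∫ x, (‖∇ u x‖ ^ 2 - ((N : ℝ) - 2) ^ 2 / (4 * ‖x‖ ^ 2) * u x ^ 2) =
        (∫ x, ‖∇ u x‖ ^ 2) - ∫ x, hardyPotential N x * u x ^ 2 := integral_sub I3 I1
    rw [h1]
    linarith [H u hu]
  · intro x hx
    rw [gradient_eq_zero_of_notMem_tsupport hx, image_eq_zero_of_notMem_tsupport hx]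
    simp
  · intro x hx
    rw [image_eq_zero_of_notMem_tsupport hx]
    simp

theorem IsSupersolution.integral_hardy_add_le {w Q : Euc N → ℝ} (hN : 3 ≤ N) (hΩ : IsOpen Ω)
    (hw : IsSupersolution (Ω \ {0}) w fun x => hardyPotential N x + Q x)
    (hu : IsTestFunction Ω u) (hQ : Integrable fun x => Q x * u x ^ 2) :
    (∫ x, hardyPotential N x * u x ^ 2) + ∫ x, Q x * u x ^ 2 ≤ ∫ x, ‖∇ u x‖ ^ 2 := by
  have I1 := integrable_hardyPotential_mul_sq hN hu.contDiff_one.continuous hu.compactSupport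
  rw [← integral_add I1 hQ]
  simp_rw [← add_mul]
  refine hw.integral_le_of_diff_zero hN hΩ hu.contDiff_one hu.compactSupport hu.support_subset ?_
  simp_rw [add_mul]
  exact I1.add hQ

theorem improvedHardy_of_divCondition (hN : 3 ≤ N) (hΩ : IsOpen Ω)
    (hb : Bornology.IsBounded Ω) (hne : Ω.Nonempty) (hdiv : DivCondition Ω) :
    ImprovedHardy Ω (1 / 4) := by
  have hfr := frontier_nonempty (by omega) hb hne
  refine improvedHardy_of_forall hN hΩ hfr fun u hu => ?_
  have I2 := integrable_sq_div_bdryDist hΩ hfr hu.contDiff_one.continuous hu.compactSupport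
    hu.support_subset
  have e : ∀ x, 1 / (4 * bdryDist Ω x ^ 2) * u x ^ 2 = 1 / 4 * (u x ^ 2 / bdryDist Ω x ^ 2) :=
    fun x => by rw [← div_div]; ring
  have h := (isSupersolution_of_divCondition hΩ hb hfr hdiv).integral_hardy_add_le hN hΩ hu
    (by simp_rw [e]; exact I2.const_mul _)
  simp_rw [e] at h
  rwa [integral_const_mul] at h

theorem exists_hardy_sub_const_le (hN : 3 ≤ N) (hΩ : IsBoundedC2Domain Ω)
    (h0 : (0 : Euc N) ∈ Ω) : ∃ K : ℝ, 0 ≤ K ∧ ∀ u : Euc N → ℝ, IsTestFunction Ω u →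
      (∫ x, hardyPotential N x * u x ^ 2) + (1 / 8 * (∫ x, u x ^ 2 / bdryDist Ω x ^ 2)
        - K * ∫ x, u x ^ 2) ≤ ∫ x, ‖∇ u x‖ ^ 2 := by
  have hfr := frontier_nonempty (by omega) hΩ.isBounded hΩ.isConnected.nonempty
  obtain ⟨w, K, hK, hw⟩ := isSupersolution_truncated hN hΩ h0
  refine ⟨K, hK, fun u hu => ?_⟩
  have I0 := integrable_sq hu.contDiff_one.continuous hu.compactSupport
  have I2 := integrable_sq_div_bdryDist hΩ.isOpen hfr hu.contDiff_one.continuous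
    hu.compactSupport hu.support_subset
  have e : ∀ x, (1 / (8 * bdryDist Ω x ^ 2) - K) * u x ^ 2 =
      1 / 8 * (u x ^ 2 / bdryDist Ω x ^ 2) - K * u x ^ 2 := fun x => by
    rw [sub_mul, ← div_div]; ring
  simp_rw [add_sub_assoc] at hw
  have h := hw.integral_hardy_add_le hN hΩ.isOpen hu
    (by simp_rw [e]; exact (I2.const_mul _).sub (I0.const_mul _))
  simp_rw [e] at h
  rwa [integral_sub (I2.const_mul _) (I0.const_mul _), integral_const_mul,
    integral_const_mul] at h

/-- A Poincaré-type improvement of the Hardy inequality on bounded open sets. -/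
theorem exists_hardy_add_const_le (hN : 3 ≤ N) (hΩ : IsOpen Ω) (hb : Bornology.IsBounded Ω) :
    ∃ L : ℝ, 0 < L ∧ ∀ u : Euc N → ℝ, IsTestFunction Ω u →
      (∫ x, hardyPotential N x * u x ^ 2) + L * (∫ x, u x ^ 2) ≤ ∫ x, ‖∇ u x‖ ^ 2 := by
  obtain ⟨R, hR0, hR⟩ := hb.exists_pos_norm_lt
  refine ⟨4 / R ^ 2, by positivity, fun u hu => ?_⟩
  have hw := isSupersolution_paraboloid (N := N) (O := Ω \ {0}) (A := R ^ 2) fun x hx =>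
    ⟨hx.2, pow_lt_pow_left₀ (hR x hx.1) (norm_nonneg _) two_ne_zero⟩
  have I0 := integrable_sq hu.contDiff_one.continuous hu.compactSupport
  have h := hw.integral_hardy_add_le hN hΩ hu (I0.const_mul _)
  rwa [integral_const_mul] at h

/-- Averaging the two inequalities with weights `L/(L+K)` and `K/(L+K)` cancels `-K ∫ u²` against
`+L ∫ u²` and leaves the constant `L/(8(L+K))`, at most `1/8`. -/
theorem exists_improvedHardy (hN : 3 ≤ N) (hΩ : IsBoundedC2Domain Ω) (h0 : (0 : Euc N) ∈ Ω) :
    ∃ C : ℝ, 0 < C ∧ C ≤ 1 / 4 ∧ ImprovedHardy Ω C := by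
  have hfr := frontier_nonempty (by omega) hΩ.isBounded hΩ.isConnected.nonempty
  obtain ⟨K, hK, H⟩ := exists_hardy_sub_const_le hN hΩ h0
  obtain ⟨L, hL, H'⟩ := exists_hardy_add_const_le hN hΩ.isOpen hΩ.isBounded
  refine ⟨L / (8 * (L + K)), by positivity, ?_,
    improvedHardy_of_forall hN hΩ.isOpen hfr fun u hu => ?_⟩
  · rw [div_le_div_iff₀ (by positivity) (by norm_num)]
    linarith
  have h := H u hu
  have h' := H' u hu
  generalize (∫ x, hardyPotential N x * u x ^ 2) = a at *
  generalize (∫ x, ‖∇ u x‖ ^ 2) = b at *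
  generalize (∫ x, u x ^ 2 / bdryDist Ω x ^ 2) = c at *
  generalize (∫ x, u x ^ 2) = d at *
  have h3 : L / (8 * (L + K)) * c * (L + K) = L * (1 / 8 * c) := by
    field_simp
  refine le_of_mul_le_mul_right ?_ (show 0 < L + K by positivity)
  rw [add_mul, h3]
  linarith [mul_le_mul_of_nonneg_left h hL.le, mul_le_mul_of_nonneg_left h' hK]

/-! ### The ball -/

theorem bdryDist_ball (hN : 0 < N) {R : ℝ} (hR : 0 < R) {x : Euc N} (hx0 : x ≠ 0)
    (hx : x ∈ Metric.ball (0 : Euc N) R) : bdryDist (Metric.ball (0 : Euc N) R) x = R - ‖x‖ := by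
  have hxR : ‖x‖ < R := mem_ball_zero_iff.1 hx
  have hn : 0 < ‖x‖ := norm_pos_iff.2 hx0
  have hfr : frontier (Metric.ball (0 : Euc N) R) = Metric.sphere 0 R := frontier_ball 0 hR.ne'
  refine le_antisymm ?_ ?_
  · have hp : (R / ‖x‖) • x ∈ frontier (Metric.ball (0 : Euc N) R) := by
      rw [hfr, mem_sphere_zero_iff_norm, norm_smul, Real.norm_of_nonneg (by positivity),
        div_mul_cancel₀ _ hn.ne']
    refine (Metric.infDist_le_dist_of_mem hp).trans_eq ?_
    have h1 : x - (R / ‖x‖) • x = -((R / ‖x‖ - 1) • x) := by module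
    rw [dist_eq_norm, h1, norm_neg, norm_smul, Real.norm_of_nonneg
      (sub_nonneg.2 ((one_le_div hn).2 hxR.le)), sub_mul, div_mul_cancel₀ _ hn.ne', one_mul]
  · refine (Metric.le_infDist (frontier_nonempty hN Metric.isBounded_ball ⟨x, hx⟩)).2
      fun p hp => ?_
    rw [hfr, mem_sphere_zero_iff_norm] at hp
    rw [dist_eq_norm, norm_sub_rev, ← hp]
    exact norm_sub_norm_le p x

theorem HasJet.hasDerivAt {g : ℝ → ℝ} {a b c : ℝ} (hg : HasJet g a b c) : HasDerivAt g b 0 := by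
  obtain ⟨g', h, -, rfl, -⟩ := hg
  exact h.self_of_nhds

theorem DifferentiableAt.hasDerivAt_line {F : Type*} [NormedAddCommGroup F] [NormedSpace ℝ F]
    {f : Euc N → F} {x : Euc N} (hf : DifferentiableAt ℝ f x) (i : Fin N) :
    HasDerivAt (fun t : ℝ => f (x + t • basisVec i)) (fderiv ℝ f x (basisVec i)) 0 :=
  hf.hasFDerivAt.hasLineDerivAt (basisVec i)

theorem weightedGradDist_ball (hN : 0 < N) {R : ℝ} (hR : 0 < R) {x : Euc N} (hx0 : x ≠ 0)
    (hx : x ∈ Metric.ball (0 : Euc N) R) :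
    weightedGradDist (Metric.ball (0 : Euc N) R) x = -(‖x‖ ^ (1 - (N : ℝ)) • x) := by
  have hn : 0 < ‖x‖ := norm_pos_iff.2 hx0
  have hev : bdryDist (Metric.ball (0 : Euc N) R) =ᶠ[𝓝 x] fun y => R - ‖y‖ := by
    filter_upwards [isOpen_ne.mem_nhds hx0, Metric.isOpen_ball.mem_nhds hx] with y h1 h2
    exact bdryDist_ball hN hR h1 h2
  have hd : DifferentiableAt ℝ (fun y : Euc N => R - ‖y‖) x :=
    (differentiableAt_const R).sub (differentiableAt_id.norm ℝ hx0)
  ext i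
  have h1 : HasDerivAt (fun t : ℝ => R - ‖x + t • basisVec i‖) (-(x i / ‖x‖)) 0 := by
    have := (hasJet_norm_sub (z := 0) hx0 i).hasDerivAt
    simp only [sub_zero] at this
    exact this.const_sub R
  have h2 : (∇ (bdryDist (Metric.ball (0 : Euc N) R)) x) i = -(x i / ‖x‖) := by
    rw [gradient_apply, hev.fderiv_eq]
    exact (hd.hasDerivAt_line i).unique h1
  have h3 : (1 : ℝ) - N = 2 - N - 1 := by ring
  rw [weightedGradDist, PiLp.smul_apply, h2, h3, Real.rpow_sub_one hn.ne', PiLp.neg_apply,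
    PiLp.smul_apply, smul_eq_mul, smul_eq_mul]
  ring

/-- Off the origin the field is `-|x|^{1-N} x`, and `div(|x|^{1-N} x) = (1 - N + N)|x|^{1-N}` is
positive. -/
theorem divCondition_ball (hN : 0 < N) {R : ℝ} (hR : 0 < R) :
    DivCondition (Metric.ball (0 : Euc N) R) := by
  have : Nonempty (Fin N) := ⟨⟨0, hN⟩⟩
  rw [DivCondition, ae_restrict_iff' Metric.isOpen_ball.measurableSet]
  filter_upwards [Measure.ae_ne volume (0 : Euc N)] with x hx0 hx
  have hn : 0 < ‖x‖ := norm_pos_iff.2 hx0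
  have hev : weightedGradDist (Metric.ball (0 : Euc N) R) =ᶠ[𝓝 x]
      fun y => -(‖y‖ ^ (1 - (N : ℝ)) • y) := by
    filter_upwards [isOpen_ne.mem_nhds hx0, Metric.isOpen_ball.mem_nhds hx] with y h1 h2
    exact weightedGradDist_ball hN hR h1 h2
  have hd : DifferentiableAt ℝ (fun y : Euc N => -(‖y‖ ^ (1 - (N : ℝ)) • y)) x :=
    (((differentiableAt_id.norm ℝ hx0).rpow_const (Or.inl hn.ne')).smul differentiableAt_id).neg
  refine ⟨hd.congr_of_eventuallyEq hev, ?_⟩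
  have h1 : ∀ i, (fderiv ℝ (weightedGradDist (Metric.ball (0 : Euc N) R)) x (basisVec i)) i =
      -(‖x‖ ^ (1 - (N : ℝ)) * ((1 - N) / ‖x‖ ^ 2 * x i ^ 2 + 1)) := fun i => by
    have h2 := (EuclideanSpace.proj i : Euc N →L[ℝ] ℝ).hasFDerivAt.comp_hasDerivAt (0 : ℝ)
      (hd.hasDerivAt_line i)
    have h3 : HasDerivAt (fun t : ℝ => x i + t) 1 0 := (hasDerivAt_id 0).const_add _
    have h4 := ((hasJet_norm_rpow hx0 (1 - (N : ℝ)) i).hasDerivAt.fun_mul h3).fun_neg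
    rw [hev.fderiv_eq]
    refine h2.unique ((h4.congr_of_eventuallyEq (Eventually.of_forall fun t => ?_)).congr_deriv ?_)
    · simp; ring
    · simp only [zero_smul, add_zero]
      ring
  rw [vdiv]
  change 0 ≤ -∑ i, (fderiv ℝ (weightedGradDist (Metric.ball (0 : Euc N) R)) x (basisVec i)) i
  simp_rw [h1]
  rw [Finset.sum_neg_distrib, neg_neg, ← Finset.mul_sum, Finset.sum_add_distrib, ← Finset.mul_sum,
    sum_sq_eq_norm_sq, div_mul_cancel₀ _ (by positivity)]
  simp
  positivity

end Conclusion

theorem theorem3p2 (N : ℕ) (hN : 3 ≤ N) :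
    (∀ Ω : Set (EuclideanSpace ℝ (Fin N)), IsBoundedC2Domain Ω → 0 ∈ Ω →
      (∃ C : ℝ, 0 < C ∧ C ≤ 1 / 4 ∧ ImprovedHardy Ω C) ∧
      (DivCondition Ω → ImprovedHardy Ω (1 / 4))) ∧
    (∀ R : ℝ, 0 < R →
      DivCondition (Metric.ball (0 : EuclideanSpace ℝ (Fin N)) R) ∧
      ImprovedHardy (Metric.ball (0 : EuclideanSpace ℝ (Fin N)) R) (1 / 4)) := by
  refine ⟨fun Ω hΩ h0 => ⟨exists_improvedHardy hN hΩ h0, fun hdiv =>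
    improvedHardy_of_divCondition hN hΩ.isOpen hΩ.isBounded ⟨0, h0⟩ hdiv⟩, fun R hR => ?_⟩
  have hdiv := divCondition_ball (N := N) (by omega) hR
  exact ⟨hdiv, improvedHardy_of_divCondition hN Metric.isOpen_ball Metric.isBounded_ball
    ⟨0, Metric.mem_ball_self hR⟩ hdiv⟩
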